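/- Let $n,m\ge 1$, $A\in\mathbb{R}^{n\times n}$, $B\in\mathbb{R}^{n\times m}$, and let $Q\in\mathbb{R}^{n\times n}$, $R\in\mathbb{R}^{m\times m}$, $\Omega\in\mathbb{R}^{n\times n}$ be symmetric positive definite. Let $\mathcal{S}_K=\{K\in\mathbb{R}^{m\times n} : A-BK \text{ is Hurwitz}\}$ be nonempty and let $$f(K)=\operatorname{tr}\big((Q+K^TRK)X(K)\big),\qquad X(K)=\int_0^\infty e^{(A-BK)t}\,\Omega\,e^{(A-BK)^Tt}\,dt$$ for $K\in\mathcal{S}_K$, and $f(K)=\infty$ otherwise. For $a\in\mathbb{R}$ let $\mathcal{S}_K(a)=\{K\in\mathcal{S}_K : f(K)\le a\}$. Write $\|\cdot\|_F$ for the Frobenius norm, $\|\cdot\|_2$ for the spectral norm of a matrix and for the operator norm (with respect to Frobenius norms) of a linear map between matrix spaces, $\mathbb{S}^n$ for the symmetric real $n\times n$ matrices, $\mathcal{A}(X)=AX+XA^T$ on $\mathbb{S}^n$, and $\mathcal{B}(Y)=BY+Y^TB^T$ from $\mathbb{R}^{m\times n}$ to $\mathbb{S}^n$. Put $$\nu=\frac{\lambda_{\min}^2(\Omega)}{4}\Big(\frac{\|A\|_2}{\sqrt{\lambda_{\min}(Q)}}+\frac{\|B\|_2}{\sqrt{\lambda_{\min}(R)}}\Big)^{-2},\qquad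 \eta=\frac{\|\mathcal{B}\|_2}{\lambda_{\min}(Q)\lambda_{\min}(\Omega)\sqrt{\nu\lambda_{\min}(R)}},$$ $$L_f=\frac{2a\|R\|_2}{\lambda_{\min}(Q)}+\frac{8a^3\|B\|_2}{\lambda_{\min}^2(Q)\lambda_{\min}(\Omega)}\Big(\frac{\|B\|_2}{\lambda_{\min}(\Omega)}+\frac{\|R\|_2}{\sqrt{\nu\lambda_{\min}(R)}}\Big),\qquad b=\frac{a^2\|R\|_2}{\nu\,\lambda_{\min}(R)\lambda_{\min}(Q)}.$$ Then $f$ has a unique global minimizer $K^\star$, it lies in $\mathcal{S}_K$, and for every $a$ with $\mathcal{S}_K(a)\neq\emptyset$ the following hold. (i) $f$ is differentiable at every point of $\mathcal{S}_K(a)$, $L_f>0$, and $\|\nabla f(K_1)-\nabla f(K_2)\|_F\le L_f\|K_1-K_2\|_F$ for all $K_1,K_2\in\mathcal{S}_K(a)$, where $\nabla f$ is the gradient for the Frobenius inner product. (ii) There is a constant $\mu_f\in(0,L_f]$, depending only on $A,B,Q,R,\Omega,a$, such that the Polyak–Łojasiewicz (PL) inequality $\|\nabla f(K)\|_F^2\ge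 2\mu_f\,(f(K)-f(K^\star))$ holds for all $K\in\mathcal{S}_K(a)$. If $\mathcal{A}$ is invertible, one such constant is $\mu_f=\mu c^2$ with $$\mu=\frac{2\lambda_{\min}(R)\lambda_{\min}(Q)}{a(1+a^2\eta)^2},\qquad c=\frac{\nu\sqrt{\nu\lambda_{\min}(R)}}{2a^2\|\mathcal{A}^{-1}\|_2\|B\|_2+a\sqrt{\nu\lambda_{\min}(R)}}.$$ (iii) For every $K^0\in\mathcal{S}_K(a)$ (in particular, for every stabilizing $K^0$ with $a=f(K^0)$) let $K^{k+1}=K^k-\alpha\nabla f(K^k)$ with $\alpha>0$. If $\alpha\le 2/L_f$, then $K^k\in\mathcal{S}_K(a)$ for all $k\ge 0$. If $\alpha\le 1/L_f$, then for every $\mu_f>0$ that satisfies the PL inequality on $\mathcal{S}_K(a)$ and $\gamma=1-\alpha\mu_f$, for all $k\ge 0$, $$f(K^k)-f(K^\star)\le\gamma^k\,(f(K^0)-f(K^\star)),\qquad \|K^k-K^\star\|_F^2\le b\,\gamma^k\,\|K^0-K^\star\|_F^2 .$$ -/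

import Mathlib

open scoped Matrix

-- `‖M‖` is the Frobenius norm of a real matrix `M`.
attribute [local instance] Matrix.frobeniusNormedAddCommGroup Matrix.frobeniusNormedSpace

namespace LQR

noncomputable section

/-- The data of a continuous-time LQR problem with `n` states and `m` inputs: the dynamics
`ẋ = A x + B u`, the weights `Q`, `R`, and the second moment `Ω` of the initial state. -/
structure Data (n m : ℕ) where
  A : Matrix (Fin n) (Fin n) ℝ
  B : Matrix (Fin n) (Fin m) ℝ
  Q : Matrix (Fin n) (Fin n) ℝ
  R : Matrix (Fin m) (Fin m) ℝ
  Ω : Matrix (Fin n) (Fin n) ℝ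

/-- The operator norm of a linear map between finite-dimensional normed spaces. -/
def opNorm {E F : Type*} [NormedAddCommGroup E] [NormedSpace ℝ E] [FiniteDimensional ℝ E]
    [NormedAddCommGroup F] [NormedSpace ℝ F] (T : E →ₗ[ℝ] F) : ℝ :=
  ‖LinearMap.toContinuousLinearMap T‖

/-- The spectral norm `‖M‖₂` of a real matrix (the operator norm for Euclidean norms). -/
def specNorm {p q : ℕ} (M : Matrix (Fin p) (Fin q) ℝ) : ℝ :=
  opNorm (Matrix.toEuclideanLin M)

/-- The smallest eigenvalue of a symmetric real matrix. -/
def lambdaMin {p : ℕ} (M : Matrix (Fin p) (Fin p) ℝ) : ℝ :=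
  sInf (spectrum ℝ M)

/-- A real matrix is Hurwitz if all its complex eigenvalues have negative real part. -/
def IsHurwitz {n : ℕ} (F : Matrix (Fin n) (Fin n) ℝ) : Prop :=
  ∀ z ∈ spectrum ℂ (F.map (algebraMap ℝ ℂ)), z.re < 0

/-- The space of symmetric real `n × n` matrices. -/
def symMat (n : ℕ) : Submodule ℝ (Matrix (Fin n) (Fin n) ℝ) where
  carrier := {X | X.IsSymm}
  add_mem' hX hY := hX.add hY
  zero_mem' := Matrix.isSymm_zero
  smul_mem' c _ hX := hX.smul c

namespace Data

variable {n m : ℕ} (S : Data n m)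

/-- The closed-loop matrix `A - B K` of the feedback law `u = -K x`. -/
def closedLoop (K : Matrix (Fin m) (Fin n) ℝ) : Matrix (Fin n) (Fin n) ℝ :=
  S.A - S.B * K

/-- The set of stabilizing feedback gains. -/
def stabilizing : Set (Matrix (Fin m) (Fin n) ℝ) :=
  {K | IsHurwitz (S.closedLoop K)}

/-- `X(K) = ∫₀^∞ e^{(A - BK)t} Ω e^{(A - BK)ᵀt} dt` (entrywise integral). -/
def X (K : Matrix (Fin m) (Fin n) ℝ) : Matrix (Fin n) (Fin n) ℝ :=
  Matrix.of fun i j => ∫ t in Set.Ioi (0 : ℝ),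
    (NormedSpace.exp (t • S.closedLoop K) * S.Ω * NormedSpace.exp (t • (S.closedLoop K)ᵀ)) i j

/-- The real number `tr ((Q + Kᵀ R K) X(K))`, the finite value of the objective at a
stabilizing gain. -/
def obj (K : Matrix (Fin m) (Fin n) ℝ) : ℝ :=
  ((S.Q + Kᵀ * S.R * K) * S.X K).trace

open Classical in
/-- The extended-valued LQR objective, infinite at gains that are not stabilizing. -/
def cost (K : Matrix (Fin m) (Fin n) ℝ) : EReal :=
  if K ∈ S.stabilizing then (S.obj K : EReal) else ⊤

/-- The sublevel set `{K stabilizing | f(K) ≤ a}`. -/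
def sublevel (a : ℝ) : Set (Matrix (Fin m) (Fin n) ℝ) :=
  {K | K ∈ S.stabilizing ∧ S.obj K ≤ a}

/-- The gradient of the objective for the Frobenius inner product: the matrix of partial
derivatives. -/
def grad (K : Matrix (Fin m) (Fin n) ℝ) : Matrix (Fin m) (Fin n) ℝ :=
  Matrix.of fun i j => fderiv ℝ S.obj K (Matrix.single i j 1)

/-- Gradient descent with constant stepsize `α`, started at `K₀`. -/
def gd (α : ℝ) (K₀ : Matrix (Fin m) (Fin n) ℝ) : ℕ → Matrix (Fin m) (Fin n) ℝ
  | 0 => K₀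
  | k + 1 => gd α K₀ k - α • S.grad (gd α K₀ k)

/-- The open-loop Lyapunov operator `X ↦ A X + X Aᵀ` on symmetric matrices. -/
def lyap : Module.End ℝ (symMat n) where
  toFun X := ⟨S.A * X.1 + X.1 * S.Aᵀ, by
    have hX : X.1ᵀ = X.1 := X.2
    change (S.A * X.1 + X.1 * S.Aᵀ)ᵀ = S.A * X.1 + X.1 * S.Aᵀ
    rw [Matrix.transpose_add, Matrix.transpose_mul, Matrix.transpose_mul,
      Matrix.transpose_transpose, hX, add_comm]⟩
  map_add' X Y := Subtype.ext (by
    simp only [Submodule.coe_add, Matrix.mul_add, Matrix.add_mul]; abel)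
  map_smul' c X := Subtype.ext (by simp [smul_add])

/-- The operator `Y ↦ B Y + Yᵀ Bᵀ` from `m × n` matrices to symmetric matrices. -/
def inputOp : Matrix (Fin m) (Fin n) ℝ →ₗ[ℝ] symMat n where
  toFun Y := ⟨S.B * Y + Yᵀ * S.Bᵀ, by
    change (S.B * Y + Yᵀ * S.Bᵀ)ᵀ = S.B * Y + Yᵀ * S.Bᵀ
    rw [Matrix.transpose_add, Matrix.transpose_mul, Matrix.transpose_mul,
      Matrix.transpose_transpose, Matrix.transpose_transpose, add_comm]⟩
  map_add' X Y := Subtype.ext (by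
    simp only [Submodule.coe_add, Matrix.transpose_add, Matrix.mul_add, Matrix.add_mul]; abel)
  map_smul' c Y := Subtype.ext (by simp [smul_add])

/-- `ν = (λ_min(Ω)² / 4) (‖A‖₂ / √λ_min(Q) + ‖B‖₂ / √λ_min(R))⁻²`. -/
def nu : ℝ :=
  lambdaMin S.Ω ^ 2 / 4 *
    ((specNorm S.A / √(lambdaMin S.Q) + specNorm S.B / √(lambdaMin S.R)) ^ 2)⁻¹

/-- `η = ‖𝓑‖₂ / (λ_min(Q) λ_min(Ω) √(ν λ_min(R)))`. -/
def eta : ℝ :=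
  opNorm S.inputOp / (lambdaMin S.Q * lambdaMin S.Ω * √(S.nu * lambdaMin S.R))

/-- `μ = 2 λ_min(R) λ_min(Q) / (a (1 + a² η)²)`. -/
def mu (a : ℝ) : ℝ :=
  2 * lambdaMin S.R * lambdaMin S.Q / (a * (1 + a ^ 2 * S.eta) ^ 2)

/-- `c = ν √(ν λ_min(R)) / (2 a² ‖𝓐⁻¹‖₂ ‖B‖₂ + a √(ν λ_min(R)))`, meaningful when the open-loop
Lyapunov operator is invertible. -/
def c (a : ℝ) : ℝ :=
  S.nu * √(S.nu * lambdaMin S.R) /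
    (2 * a ^ 2 * opNorm (Ring.inverse S.lyap) * specNorm S.B + a * √(S.nu * lambdaMin S.R))

/-- The explicit constant `μ_f = μ c²`. -/
def muF (a : ℝ) : ℝ :=
  S.mu a * S.c a ^ 2

/-- The explicit Lipschitz constant `L_f` of the gradient on the sublevel set. -/
def LF (a : ℝ) : ℝ :=
  2 * a * specNorm S.R / lambdaMin S.Q +
    8 * a ^ 3 * specNorm S.B / (lambdaMin S.Q ^ 2 * lambdaMin S.Ω) *
      (specNorm S.B / lambdaMin S.Ω + specNorm S.R / √(S.nu * lambdaMin S.R))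

/-- `b = a² ‖R‖₂ / (ν λ_min(R) λ_min(Q))`. -/
def b (a : ℝ) : ℝ :=
  a ^ 2 * specNorm S.R / (S.nu * lambdaMin S.R * lambdaMin S.Q)

/-- The Polyak–Łojasiewicz inequality with constant `μ` on the sublevel set of level `a`, relative
to the optimal gain `Kopt`. -/
def IsPL (Kopt : Matrix (Fin m) (Fin n) ℝ) (a μ : ℝ) : Prop :=
  ∀ K ∈ S.sublevel a, 2 * μ * (S.obj K - S.obj Kopt) ≤ ‖S.grad K‖ ^ 2

end Data

end

end LQR

/-!
The proof stays with the gain `K` and uses no convex reparametrization. Write `F = A - B K`, let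
`X = X(K)` solve `F X + X Fᵀ + Ω = 0`, let `P = P(K)` solve `Fᵀ P + P F + Q + Kᵀ R K = 0`, and put
`E = R K - Bᵀ P`.

*Lyapunov equations.* For Hurwitz `F` the spectral mapping theorem for `exp` and Gelfand's formula
give `e^{tF} → 0`, so that `d/dt (e^{tF} Z e^{tFᵀ})` integrates to uniqueness, existence, positivity
and the integral formula (`lyapunov_eq_zero`, `lyapunov_posSemidef`, `integral_exp_eq`). Conversely
a positive semidefinite solution for a positive definite right-hand side certifies that `F` is
Hurwitz (`isHurwitz_of_lyapunov`). Comparing right-hand sides bounds the solution for any symmetric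
right-hand side by the trace of `X` or `P` (`norm_le_of_lyapunov`).

*Bounds on a sublevel set.* The trace bounds for `X` and `P` follow from `f(K) = tr (P Ω)`, and
`X ≥ ν / a` from the Lyapunov equation tested with a bottom eigenvector of `X` (`nu_div_le`).

*Exact differences.* With `D = K₁ - K₂`, the identity
`f(K₁) - f(K₂) = tr ((Dᵀ R D + Dᵀ E₂ + E₂ᵀ D) X₁)` (`obj_sub_obj`) yields the gradient
`2 E X`, and, by completing the square, a Polyak–Łojasiewicz constant `2 λ_min(R) λ_min(Q) ν² / a³`
(`isPL_plConst`). This constant needs no assumption on the open loop and is at least `μ c²`, since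
`μ ≤ 2 λ_min(R) λ_min(Q) / a` and `c ≤ ν / a`. At the minimizer `E = 0`, so the identity also gives
quadratic growth from below and above, hence uniqueness of the minimizer and the constant `b`.
Likewise the differences `X₁ - X₂` and `P₁ - P₂` solve Lyapunov equations, and the resulting exact
expansion of `2 E₁ X₁ - 2 E₂ X₂` gives the Lipschitz constant `L_f` (`norm_E_mul_X_sub_le`). No
segment between the two gains enters, which matters because sublevel sets need not be convex.

*Descent.* A sublevel set is compact, being the projection of a compact set of pairs `(K, X)`; this
gives the minimizer. Along a gradient step the objective decreases as long as the path stays in the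
sublevel set, and by closedness it cannot leave before length `2 / L_f` (`segment_subset`).
-/

namespace LQR

open Matrix

/-! ### Frobenius norm, spectral norm and trace -/

section Norms

variable {p q r : ℕ}

lemma norm_sq_eq_sum (M : Matrix (Fin p) (Fin q) ℝ) : ‖M‖ ^ 2 = ∑ i, ∑ j, M i j ^ 2 := by
  rw [Matrix.frobenius_norm_def, ← Real.sqrt_eq_rpow, Real.sq_sqrt (by positivity)]
  simp

lemma trace_mul_eq_sum (M : Matrix (Fin p) (Fin q) ℝ) (N : Matrix (Fin q) (Fin p) ℝ) :
    (M * N).trace = ∑ i, ∑ j, M i j * N j i := by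
  simp [Matrix.trace, Matrix.mul_apply]

lemma trace_transpose_mul_self (M : Matrix (Fin p) (Fin q) ℝ) : (Mᵀ * M).trace = ‖M‖ ^ 2 := by
  rw [norm_sq_eq_sum, trace_mul_eq_sum, Finset.sum_comm]
  simp [sq]

lemma trace_mul_transpose_self (M : Matrix (Fin p) (Fin q) ℝ) : (M * Mᵀ).trace = ‖M‖ ^ 2 := by
  rw [Matrix.trace_mul_comm, trace_transpose_mul_self]

lemma abs_trace_mul_le (M : Matrix (Fin p) (Fin q) ℝ) (N : Matrix (Fin q) (Fin p) ℝ) :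
    |(M * N).trace| ≤ ‖M‖ * ‖N‖ := by
  refine abs_le_of_sq_le_sq ?_ (by positivity)
  have hN : ‖N‖ ^ 2 = ∑ i, ∑ j, N j i ^ 2 := by rw [norm_sq_eq_sum, Finset.sum_comm]
  rw [mul_pow, norm_sq_eq_sum M, hN, trace_mul_eq_sum, ← Finset.sum_product',
    ← Finset.sum_product', ← Finset.sum_product']
  exact Finset.sum_mul_sq_le_sq_mul_sq _ _ _

lemma trace_mul_le (M : Matrix (Fin p) (Fin q) ℝ) (N : Matrix (Fin q) (Fin p) ℝ) :
    (M * N).trace ≤ ‖M‖ * ‖N‖ :=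
  (le_abs_self _).trans (abs_trace_mul_le M N)

lemma specNorm_nonneg (M : Matrix (Fin p) (Fin q) ℝ) : 0 ≤ specNorm M := norm_nonneg _

lemma norm_mul_le_specNorm_mul (B : Matrix (Fin p) (Fin q) ℝ) (N : Matrix (Fin q) (Fin r) ℝ) :
    ‖B * N‖ ≤ specNorm B * ‖N‖ := by
  refine le_of_sq_le_sq ?_ (mul_nonneg (specNorm_nonneg B) (norm_nonneg N))
  rw [mul_pow, norm_sq_eq_sum, norm_sq_eq_sum N, Finset.sum_comm,
    Finset.sum_comm (f := fun i j => N i j ^ 2), Finset.mul_sum]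
  refine Finset.sum_le_sum fun j _ => ?_
  have h := (LinearMap.toContinuousLinearMap (Matrix.toEuclideanLin B)).le_opNorm
    (WithLp.toLp 2 (fun i => N i j))
  have h2 := pow_le_pow_left₀ (norm_nonneg _) h 2
  rw [mul_pow, EuclideanSpace.norm_sq_eq, EuclideanSpace.norm_sq_eq] at h2
  simpa [Matrix.toLpLin_apply, Matrix.mulVec, dotProduct, Matrix.mul_apply, specNorm, opNorm]
    using h2

lemma norm_mul_le_mul_specNorm (N : Matrix (Fin r) (Fin p) ℝ) (B : Matrix (Fin p) (Fin q) ℝ) :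
    ‖N * B‖ ≤ ‖N‖ * specNorm B := by
  by_cases h0 : ‖N * B‖ = 0
  · rw [h0]; exact mul_nonneg (norm_nonneg N) (specNorm_nonneg B)
  have h1 : ‖N * B‖ ^ 2 ≤ ‖N‖ * (specNorm B * ‖N * B‖) := by
    calc ‖N * B‖ ^ 2 = (N * (B * (N * B)ᵀ)).trace := by
          rw [← trace_mul_transpose_self, Matrix.mul_assoc]
      _ ≤ ‖N‖ * ‖B * (N * B)ᵀ‖ := trace_mul_le _ _
      _ ≤ ‖N‖ * (specNorm B * ‖N * B‖) := by
          have := norm_mul_le_specNorm_mul B (N * B)ᵀ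
          rw [Matrix.frobenius_norm_transpose] at this
          gcongr
  have h2 : 0 < ‖N * B‖ := lt_of_le_of_ne (norm_nonneg _) (Ne.symm h0)
  nlinarith

lemma norm_transpose_mul_le (B : Matrix (Fin p) (Fin q) ℝ) (N : Matrix (Fin p) (Fin r) ℝ) :
    ‖Bᵀ * N‖ ≤ specNorm B * ‖N‖ := by
  have h := norm_mul_le_mul_specNorm Nᵀ B
  rw [← Matrix.frobenius_norm_transpose, Matrix.transpose_mul, Matrix.transpose_transpose,
    mul_comm (specNorm B)]
  rwa [Matrix.frobenius_norm_transpose] at h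

end Norms

/-! ### Positive semidefinite matrices -/

section PosSemidef

variable {p q : ℕ}

lemma _root_.Matrix.PosSemidef.isSymm {X : Matrix (Fin p) (Fin p) ℝ} (hX : X.PosSemidef) :
    Xᵀ = X := by
  simpa [Matrix.conjTranspose_eq_transpose_of_trivial] using hX.isHermitian.eq

lemma posSemidef_of_forall {X : Matrix (Fin p) (Fin p) ℝ} (hX : Xᵀ = X)
    (h : ∀ v : Fin p → ℝ, 0 ≤ v ⬝ᵥ (X *ᵥ v)) : X.PosSemidef :=
  .of_dotProduct_mulVec_nonneg (by simpa [Matrix.IsHermitian] using hX) (by simpa using h)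

lemma exists_eq_transpose_mul_self {X : Matrix (Fin p) (Fin p) ℝ} (hX : X.PosSemidef) :
    ∃ T : Matrix (Fin p) (Fin p) ℝ, X = Tᵀ * T := by
  open scoped MatrixOrder in
  obtain ⟨T, hT⟩ := CStarAlgebra.nonneg_iff_eq_star_mul_self.1 hX.nonneg
  exact ⟨T, by simpa [Matrix.star_eq_conjTranspose] using hT⟩

lemma posSemidef_transpose_mul_self (T : Matrix (Fin q) (Fin p) ℝ) : (Tᵀ * T).PosSemidef := by
  simpa using Matrix.posSemidef_conjTranspose_mul_self T

lemma _root_.Matrix.PosSemidef.congr_transpose {X : Matrix (Fin p) (Fin p) ℝ} (hX : X.PosSemidef)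
    (T : Matrix (Fin q) (Fin p) ℝ) : (T * X * Tᵀ).PosSemidef := by
  simpa using hX.mul_mul_conjTranspose_same T

lemma norm_le_trace {X : Matrix (Fin p) (Fin p) ℝ} (hX : X.PosSemidef) : ‖X‖ ≤ X.trace := by
  obtain ⟨T, rfl⟩ := exists_eq_transpose_mul_self hX
  rw [trace_transpose_mul_self, sq]
  simpa [Matrix.frobenius_norm_transpose] using Matrix.frobenius_norm_mul Tᵀ T

lemma trace_mul_nonneg {X Y : Matrix (Fin p) (Fin p) ℝ} (hX : X.PosSemidef) (hY : Y.PosSemidef) :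
    0 ≤ (X * Y).trace := by
  obtain ⟨T, rfl⟩ := exists_eq_transpose_mul_self hX
  rw [Matrix.mul_assoc, Matrix.trace_mul_comm]
  exact (hY.congr_transpose T).trace_nonneg

lemma trace_mul_le_trace_mul {X Y Z : Matrix (Fin p) (Fin p) ℝ} (hXY : (Y - X).PosSemidef)
    (hZ : Z.PosSemidef) : (X * Z).trace ≤ (Y * Z).trace := by
  have := trace_mul_nonneg hXY hZ
  rw [Matrix.sub_mul, Matrix.trace_sub] at this
  linarith

/-- `λ tr X ≤ tr (M X)` if `M ≥ λ` and `X ≥ 0`. -/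
lemma mul_trace_le_trace_mul {M X : Matrix (Fin p) (Fin p) ℝ} {l : ℝ}
    (hM : (M - l • (1 : Matrix (Fin p) (Fin p) ℝ)).PosSemidef) (hX : X.PosSemidef) :
    l * X.trace ≤ (M * X).trace := by
  simpa using trace_mul_le_trace_mul hM hX

/-- Two-sided bounds `-W ≤ Z ≤ W` control the Frobenius norm, because
`tr ((W - Z) (W + Z)) = ‖W‖² - ‖Z‖²`. -/
lemma norm_le_trace_of_sandwich {Z W : Matrix (Fin p) (Fin p) ℝ} (hZ : Zᵀ = Z)
    (hW : W.PosSemidef) (h₁ : (W - Z).PosSemidef) (h₂ : (W + Z).PosSemidef) : ‖Z‖ ≤ W.trace := by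
  refine le_trans (le_of_sq_le_sq ?_ (norm_nonneg W)) (norm_le_trace hW)
  have h := trace_mul_nonneg h₁ h₂
  rw [← trace_transpose_mul_self, ← trace_transpose_mul_self W, hZ, hW.isSymm]
  simp only [Matrix.sub_mul, Matrix.mul_add, Matrix.trace_sub, Matrix.trace_add] at h
  rw [Matrix.trace_mul_comm W Z] at h
  linarith

lemma abs_dotProduct_mulVec_le (C : Matrix (Fin p) (Fin p) ℝ) (v : Fin p → ℝ) :
    |v ⬝ᵥ (C *ᵥ v)| ≤ ‖C‖ * (v ⬝ᵥ v) := by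
  have h1 : v ⬝ᵥ (C *ᵥ v) = (C * Matrix.vecMulVec v v).trace := by
    rw [Matrix.mul_vecMulVec, Matrix.trace_vecMulVec, dotProduct_comm]
  have h2 : ‖Matrix.vecMulVec v v‖ ≤ v ⬝ᵥ v := by
    have := norm_le_trace (X := Matrix.vecMulVec v v)
      (by simpa using Matrix.posSemidef_vecMulVec_self_star v)
    rwa [Matrix.trace_vecMulVec] at this
  rw [h1]
  exact (abs_trace_mul_le _ _).trans (by gcongr)

lemma smul_one_sub_posSemidef {C : Matrix (Fin p) (Fin p) ℝ} {c : ℝ} (hC : Cᵀ = C)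
    (hc : ‖C‖ ≤ c) : (c • (1 : Matrix (Fin p) (Fin p) ℝ) - C).PosSemidef := by
  refine posSemidef_of_forall (by simp [hC]) fun v => ?_
  have h := abs_le.1 (abs_dotProduct_mulVec_le C v)
  have hv : 0 ≤ v ⬝ᵥ v := by simpa using dotProduct_star_self_nonneg v
  have : ‖C‖ * (v ⬝ᵥ v) ≤ c * (v ⬝ᵥ v) := by gcongr
  simp only [Matrix.sub_mulVec, Matrix.smul_mulVec, Matrix.one_mulVec, dotProduct_sub,
    dotProduct_smul, smul_eq_mul]
  linarith [h.2]

lemma smul_one_add_posSemidef {C : Matrix (Fin p) (Fin p) ℝ} {c : ℝ} (hC : Cᵀ = C)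
    (hc : ‖C‖ ≤ c) : (c • (1 : Matrix (Fin p) (Fin p) ℝ) + C).PosSemidef := by
  simpa using smul_one_sub_posSemidef (C := -C) (c := c) (by simp [hC]) (by simpa using hc)

/-- The smallest eigenvalue of a symmetric matrix is attained at a unit eigenvector, written here
as a matrix with one column, and bounds the matrix from below. -/
lemma lambdaMin_spec (hp : 0 < p) {M : Matrix (Fin p) (Fin p) ℝ} (hM : Mᵀ = M) :
    (M - lambdaMin M • (1 : Matrix (Fin p) (Fin p) ℝ)).PosSemidef ∧
      ∃ V : Matrix (Fin p) (Fin 1) ℝ, ‖V‖ = 1 ∧ M * V = lambdaMin M • V := by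
  have hH : M.IsHermitian := by simpa [Matrix.IsHermitian] using hM
  have : Nonempty (Fin p) := ⟨⟨0, hp⟩⟩
  obtain ⟨i, hi⟩ := Finite.exists_min hH.eigenvalues
  have hl : lambdaMin M = hH.eigenvalues i := by
    rw [lambdaMin, hH.spectrum_real_eq_range_eigenvalues]
    exact IsLeast.csInf_eq ⟨⟨i, rfl⟩, by rintro _ ⟨j, rfl⟩; exact hi j⟩
  constructor
  · have hH' : (M - lambdaMin M • (1 : Matrix (Fin p) (Fin p) ℝ)).IsHermitian := by
      simp [Matrix.IsHermitian, hM]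
    refine hH'.posSemidef_iff_eigenvalues_nonneg.2 fun j => ?_
    have hj := hH'.mulVec_eigenvectorBasis j
    set w := (hH'.eigenvectorBasis j).ofLp with hw
    have hw0 : w ≠ 0 := by
      intro h0
      have := hH'.eigenvectorBasis.orthonormal.ne_zero j
      exact this (by ext k; simpa using congrFun h0 k)
    have hmem : lambdaMin M + hH'.eigenvalues j ∈ spectrum ℝ M := by
      rw [← Matrix.spectrum_toLin', ← Module.End.hasEigenvalue_iff_mem_spectrum]
      refine Module.End.hasEigenvalue_of_hasEigenvector (x := w) ⟨?_, hw0⟩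
      rw [Module.End.mem_eigenspace_iff, Matrix.toLin'_apply]
      rw [Matrix.sub_mulVec, Matrix.smul_mulVec, Matrix.one_mulVec, sub_eq_iff_eq_add] at hj
      rw [hj, add_smul, add_comm]
    rw [hH.spectrum_real_eq_range_eigenvalues] at hmem
    obtain ⟨k, hk⟩ := hmem
    have := hi k
    simp only [Pi.zero_apply]
    linarith
  · refine ⟨Matrix.replicateCol (Fin 1) (hH.eigenvectorBasis i).ofLp, ?_, ?_⟩
    · exact (Matrix.frobenius_norm_replicateCol _).trans (hH.eigenvectorBasis.orthonormal.1 i)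
    · rw [← Matrix.replicateCol_mulVec, hH.mulVec_eigenvectorBasis, hl, Matrix.replicateCol_smul]

lemma lambdaMin_pos (hp : 0 < p) {M : Matrix (Fin p) (Fin p) ℝ} (hM : M.PosDef) :
    0 < lambdaMin M := by
  obtain ⟨-, V, hV, hMV⟩ := lambdaMin_spec hp hM.posSemidef.isSymm
  have h1 : (Vᵀ * (M * V)) 0 0 = lambdaMin M := by
    have : (Vᵀ * V).trace = 1 := by rw [trace_transpose_mul_self, hV]; norm_num
    rw [hMV]
    simp only [Matrix.trace, Finset.univ_unique, Finset.sum_singleton, Matrix.diag_apply] at this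
    simpa using congrArg (lambdaMin M * ·) this
  have hv : (fun i => V i 0) ≠ 0 := by
    intro h0
    have : V = 0 := by ext i j; rw [Subsingleton.elim j 0]; exact congrFun h0 i
    simp [this] at hV
  have h2 := hM.dotProduct_mulVec_pos hv
  rw [← h1]
  simpa [Matrix.mul_apply, dotProduct, Matrix.mulVec] using h2

end PosSemidef

/-! ### Decay of the exponential of a Hurwitz matrix -/

section Exponential

open Filter Topology NormedSpace

attribute [local instance] Matrix.frobeniusNormedRing Matrix.frobeniusNormedAlgebra

variable {p : ℕ}

lemma exp_mulVec_of_mulVec {G : Matrix (Fin p) (Fin p) ℂ} {v : Fin p → ℂ} {z : ℂ}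
    (h : G *ᵥ v = z • v) : exp G *ᵥ v = Complex.exp z • v := by
  have h1 := (exp_series_hasSum_exp' (𝕂 := ℂ) G).map (Matrix.mulVecBilin ℂ ℂ |>.flip v)
    (LinearMap.continuous_of_finiteDimensional _)
  have h2 := (exp_series_hasSum_exp' (𝕂 := ℂ) z).smul_const v
  rw [← Complex.exp_eq_exp_ℂ] at h2
  have hpow : ∀ n : ℕ, G ^ n *ᵥ v = z ^ n • v := by
    intro n
    induction n with
    | zero => simp
    | succ n ih => rw [pow_succ, ← Matrix.mulVec_mulVec, h, Matrix.mulVec_smul, ih, smul_smul,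
        pow_succ, mul_comm]
  refine h1.unique ?_
  convert h2 using 2 with n
  simp [hpow, smul_smul]

/-- Every eigenvalue of `exp G` is the exponential of an eigenvalue of `G`: the eigenspace is
invariant under `G`, so it contains an eigenvector of `G`. -/
lemma exists_eq_exp_of_mem_spectrum_exp {G : Matrix (Fin p) (Fin p) ℂ} {μ : ℂ}
    (hμ : μ ∈ spectrum ℂ (exp G)) : ∃ z ∈ spectrum ℂ G, μ = Complex.exp z := by
  rw [← Matrix.spectrum_toLin', ← Module.End.hasEigenvalue_iff_mem_spectrum] at hμ
  have hcomm : Commute (Matrix.toLin' (exp G)) (Matrix.toLin' G) := by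
    have : Commute (exp G) G := (Commute.refl G).exp_left
    rw [commute_iff_eq, Module.End.mul_eq_comp, Module.End.mul_eq_comp, ← Matrix.toLin'_mul,
      ← Matrix.toLin'_mul, this.eq]
  have hmaps := Module.End.mapsTo_genEigenspace_of_comm hcomm μ 1
  let E := Module.End.eigenspace (Matrix.toLin' (exp G)) μ
  have hE : Nontrivial E := Submodule.nontrivial_iff_ne_bot.2 hμ
  obtain ⟨z, hz⟩ := Module.End.exists_eigenvalue ((Matrix.toLin' G).restrict hmaps)
  obtain ⟨⟨v, hvE⟩, hv⟩ := hz.exists_hasEigenvector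
  have hv0 : v ≠ 0 := fun h => hv.2 (Subtype.ext h)
  have hGv : G *ᵥ v = z • v := by
    have : Matrix.toLin' G v = z • v := congrArg Subtype.val hv.apply_eq_smul
    simpa using this
  refine ⟨z, ?_, ?_⟩
  · rw [← Matrix.spectrum_toLin', ← Module.End.hasEigenvalue_iff_mem_spectrum]
    exact Module.End.hasEigenvalue_of_hasEigenvector (x := v)
      ⟨Module.End.mem_eigenspace_iff.2 (by simpa using hGv), hv0⟩
  · have h1 : exp G *ᵥ v = μ • v := by simpa using Module.End.mem_eigenspace_iff.1 hvE
    rw [exp_mulVec_of_mulVec hGv] at h1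
    exact (smul_left_injective ℂ hv0 h1).symm

lemma tendsto_pow_of_spectralRadius_lt_one {G : Matrix (Fin p) (Fin p) ℂ}
    (h : spectralRadius ℂ G < 1) : Tendsto (fun n : ℕ => G ^ n) atTop (𝓝 0) := by
  obtain ⟨r, hr, hr1⟩ := ENNReal.lt_iff_exists_nnreal_btwn.1 h
  have hr1' : r < 1 := by exact_mod_cast hr1
  have hev := (spectrum.pow_nnnorm_pow_one_div_tendsto_nhds_spectralRadius G).eventually_lt_const hr
  refine squeeze_zero_norm' ?_ (tendsto_pow_atTop_nhds_zero_of_lt_one r.2 (by exact_mod_cast hr1'))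
  filter_upwards [hev, eventually_gt_atTop 0] with n hn hn0
  have hn0' : (0 : ℝ) < n := by exact_mod_cast hn0
  have h1 := ENNReal.rpow_lt_rpow hn hn0'
  rw [← ENNReal.rpow_mul, one_div_mul_cancel hn0'.ne', ENNReal.rpow_one, ENNReal.rpow_natCast] at h1
  have h2 : ‖G ^ n‖₊ < r ^ n := by exact_mod_cast h1
  exact_mod_cast h2.le

/-- Split `exp (t G)` at the integer part of `t`: the powers of `exp G` tend to zero because its
spectral radius is less than one. -/
lemma tendsto_exp_smul_of_re_neg {G : Matrix (Fin p) (Fin p) ℂ}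
    (hG : ∀ z ∈ spectrum ℂ G, z.re < 0) :
    Tendsto (fun t : ℝ => exp (t • G)) atTop (𝓝 0) := by
  rcases Nat.eq_zero_or_pos p with rfl | hp
  · exact tendsto_const_nhds.congr fun t => Subsingleton.elim _ _
  have : Nonempty (Fin p) := ⟨⟨0, hp⟩⟩
  have hrad : spectralRadius ℂ (exp G) < 1 := by
    have := spectrum.spectralRadius_lt_of_forall_lt (exp G) (r := 1) fun μ hμ => by
      obtain ⟨z, hz, rfl⟩ := exists_eq_exp_of_mem_spectrum_exp hμ
      rw [← NNReal.coe_lt_coe, coe_nnnorm, Complex.norm_exp]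
      simpa using hG z hz
    simpa using this
  have hpow := tendsto_pow_of_spectralRadius_lt_one hrad
  have hcont : Continuous fun s : ℝ => exp (s • G) :=
    continuous_iff_continuousAt.2 fun s => (hasDerivAt_exp_smul_const G s).continuousAt
  obtain ⟨C, hC⟩ := (isCompact_Icc (a := (0 : ℝ)) (b := 1)).exists_bound_of_continuousOn
    hcont.continuousOn
  have h0 : Tendsto (fun t : ℝ => ‖exp G ^ ⌊t⌋₊‖ * C) atTop (𝓝 0) := by
    simpa using ((hpow.norm.comp (tendsto_nat_floor_atTop (α := ℝ))).mul_const C)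
  refine squeeze_zero_norm' ?_ h0
  filter_upwards [eventually_ge_atTop 0] with t ht
  have hsplit : exp (t • G) = exp G ^ ⌊t⌋₊ * exp ((t - ⌊t⌋₊) • G) := by
    rw [← Matrix.exp_nsmul, ← Matrix.exp_add_of_commute]
    · rw [← Nat.cast_smul_eq_nsmul ℝ, ← add_smul]; congr 2; ring
    · exact ((Commute.refl G).smul_right _).smul_left _
  rw [hsplit]
  refine (norm_mul_le _ _).trans ?_
  gcongr
  refine hC _ ⟨sub_nonneg.2 (Nat.floor_le ht), ?_⟩
  linarith [(Nat.lt_floor_add_one t).le]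

lemma IsHurwitz.tendsto_exp {F : Matrix (Fin p) (Fin p) ℝ} (hF : IsHurwitz F) :
    Tendsto (fun t : ℝ => exp (t • F)) atTop (𝓝 0) := by
  have h := tendsto_exp_smul_of_re_neg hF
  refine tendsto_zero_iff_norm_tendsto_zero.2
    ((tendsto_zero_iff_norm_tendsto_zero.1 h).congr fun t => ?_)
  let φ : Matrix (Fin p) (Fin p) ℝ →+* Matrix (Fin p) (Fin p) ℂ := (algebraMap ℝ ℂ).mapMatrix
  have hφ : Continuous φ := continuous_id.matrix_map (Complex.continuous_ofReal)
  let _ : NormedAlgebra ℚ (Matrix (Fin p) (Fin p) ℝ) := NormedAlgebra.restrictScalars ℚ ℝ _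
  have h1 := map_exp φ hφ (t • F)
  have h2 : φ (t • F) = t • F.map (algebraMap ℝ ℂ) := by
    ext i j; simp [φ]
  rw [h2] at h1
  exact (congrArg norm h1.symm).trans (Matrix.frobenius_norm_map_eq _ _ fun x => by simp)

lemma IsHurwitz.transpose {F : Matrix (Fin p) (Fin p) ℝ} (hF : IsHurwitz F) : IsHurwitz Fᵀ := by
  intro z hz
  rw [Matrix.transpose_map, Matrix.mem_spectrum_iff_isRoot_charpoly, Matrix.charpoly_transpose,
    ← Matrix.mem_spectrum_iff_isRoot_charpoly] at hz
  exact hF z hz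

end Exponential

/-! ### The Lyapunov equation -/

section Lyapunov

open Filter Topology NormedSpace MeasureTheory

variable {p : ℕ}

section Flow

attribute [local instance] Matrix.frobeniusNormedRing Matrix.frobeniusNormedAlgebra

lemma hasDerivAt_exp_mul_mul_exp (F Z : Matrix (Fin p) (Fin p) ℝ) (t : ℝ) :
    HasDerivAt (fun t : ℝ => exp (t • F) * Z * exp (t • Fᵀ))
      (exp (t • F) * (F * Z + Z * Fᵀ) * exp (t • Fᵀ)) t := by
  have h := ((hasDerivAt_exp_smul_const F t).mul_const Z).mul (hasDerivAt_exp_smul_const' Fᵀ t)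
  exact h.congr_deriv (by noncomm_ring)

lemma tendsto_exp_mul_mul_exp {F : Matrix (Fin p) (Fin p) ℝ} (hF : IsHurwitz F)
    (Z : Matrix (Fin p) (Fin p) ℝ) :
    Tendsto (fun t : ℝ => exp (t • F) * Z * exp (t • Fᵀ)) atTop (𝓝 0) := by
  simpa using (hF.tendsto_exp.mul_const Z).mul hF.transpose.tendsto_exp

lemma hasDerivAt_linear_exp (l : Matrix (Fin p) (Fin p) ℝ →ₗ[ℝ] ℝ)
    {F Z W : Matrix (Fin p) (Fin p) ℝ} (h : F * Z + Z * Fᵀ + W = 0) (t : ℝ) :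
    HasDerivAt (fun t : ℝ => -l (exp (t • F) * Z * exp (t • Fᵀ)))
      (l (exp (t • F) * W * exp (t • Fᵀ))) t := by
  have h1 := ((LinearMap.toContinuousLinearMap l).hasFDerivAt.comp_hasDerivAt t
    (hasDerivAt_exp_mul_mul_exp F Z t)).neg
  rw [eq_neg_of_add_eq_zero_left h] at h1
  refine h1.congr_deriv ?_
  change -l (exp (t • F) * -W * exp (t • Fᵀ)) = _
  rw [Matrix.mul_neg, Matrix.neg_mul, map_neg, neg_neg]

lemma tendsto_linear_exp (l : Matrix (Fin p) (Fin p) ℝ →ₗ[ℝ] ℝ)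
    {F : Matrix (Fin p) (Fin p) ℝ} (hF : IsHurwitz F) (Z : Matrix (Fin p) (Fin p) ℝ) :
    Tendsto (fun t : ℝ => -l (exp (t • F) * Z * exp (t • Fᵀ))) atTop (𝓝 0) := by
  have h1 := (((LinearMap.toContinuousLinearMap l).continuous.tendsto 0).comp
    (tendsto_exp_mul_mul_exp hF Z)).neg
  simpa using h1

end Flow

lemma exp_smul_transpose (F : Matrix (Fin p) (Fin p) ℝ) (t : ℝ) :
    exp (t • Fᵀ) = (exp (t • F))ᵀ := by
  rw [← Matrix.exp_transpose, Matrix.transpose_smul]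

/-- The linear functional `M ↦ vᵀ M v`. -/
def quadLin (v : Fin p → ℝ) : Matrix (Fin p) (Fin p) ℝ →ₗ[ℝ] ℝ where
  toFun M := v ⬝ᵥ (M *ᵥ v)
  map_add' M N := by rw [Matrix.add_mulVec, dotProduct_add]
  map_smul' c M := by simp [Matrix.smul_mulVec]

/-- The linear functional `M ↦ M i j`. -/
def entryLin (i j : Fin p) : Matrix (Fin p) (Fin p) ℝ →ₗ[ℝ] ℝ where
  toFun M := M i j
  map_add' _ _ := rfl
  map_smul' _ _ := rfl

@[simp]
lemma quadLin_apply (v : Fin p → ℝ) (M : Matrix (Fin p) (Fin p) ℝ) :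
    quadLin v M = v ⬝ᵥ (M *ᵥ v) :=
  rfl

@[simp]
lemma entryLin_apply (i j : Fin p) (M : Matrix (Fin p) (Fin p) ℝ) : entryLin i j M = M i j :=
  rfl

/-- The solution of a Lyapunov equation with Hurwitz `F` and positive semidefinite `W` is positive
semidefinite: `vᵀ e^{tF} Z e^{tFᵀ} v` is antitone in `t` and tends to zero. -/
lemma lyapunov_posSemidef {F Z W : Matrix (Fin p) (Fin p) ℝ} (hF : IsHurwitz F) (hZ : Zᵀ = Z)
    (hW : W.PosSemidef) (h : F * Z + Z * Fᵀ + W = 0) : Z.PosSemidef := by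
  refine posSemidef_of_forall hZ fun v => ?_
  have hd := hasDerivAt_linear_exp (quadLin v) h
  have hmono : Monotone fun t : ℝ => -quadLin v (exp (t • F) * Z * exp (t • Fᵀ)) := by
    refine monotone_of_deriv_nonneg (fun t => (hd t).differentiableAt) fun t => ?_
    rw [(hd t).deriv, exp_smul_transpose]
    simpa using (hW.congr_transpose (exp (t • F))).dotProduct_mulVec_nonneg v
  have := hmono.ge_of_tendsto (tendsto_linear_exp (quadLin v) hF Z) 0
  simpa using this

/-- The homogeneous Lyapunov equation with Hurwitz `F` has only the zero solution, since
`e^{tF} Z e^{tFᵀ}` is constant in `t` and tends to zero. -/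
lemma lyapunov_eq_zero {F Z : Matrix (Fin p) (Fin p) ℝ} (hF : IsHurwitz F)
    (h : F * Z + Z * Fᵀ = 0) : Z = 0 := by
  ext i j
  have hd := hasDerivAt_linear_exp (entryLin i j) (W := 0) (by rw [h, add_zero])
  have hc : ∀ t : ℝ, -entryLin i j (exp (t • F) * Z * exp (t • Fᵀ)) = -Z i j := by
    intro t
    have := is_const_of_deriv_eq_zero (fun t => (hd t).differentiableAt)
      (fun t => by rw [(hd t).deriv]; simp) t 0
    simpa using this
  have := tendsto_nhds_unique ((tendsto_linear_exp (entryLin i j) hF Z).congr hc)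
    tendsto_const_nhds
  simpa using this.symm

lemma lyapunov_unique {F Z₁ Z₂ W : Matrix (Fin p) (Fin p) ℝ} (hF : IsHurwitz F)
    (h₁ : F * Z₁ + Z₁ * Fᵀ + W = 0) (h₂ : F * Z₂ + Z₂ * Fᵀ + W = 0) : Z₁ = Z₂ := by
  refine sub_eq_zero.1 (lyapunov_eq_zero hF ?_)
  rw [Matrix.mul_sub, Matrix.sub_mul, ← sub_self (0 : Matrix (Fin p) (Fin p) ℝ)]
  nth_rw 1 [← h₁]
  rw [← h₂]
  abel

lemma exists_lyapunov {F : Matrix (Fin p) (Fin p) ℝ} (hF : IsHurwitz F)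
    (W : Matrix (Fin p) (Fin p) ℝ) : ∃ Z, F * Z + Z * Fᵀ + W = 0 := by
  let T : Matrix (Fin p) (Fin p) ℝ →ₗ[ℝ] Matrix (Fin p) (Fin p) ℝ :=
    LinearMap.mulLeft ℝ F + LinearMap.mulRight ℝ Fᵀ
  have hinj : Function.Injective T := by
    rw [← LinearMap.ker_eq_bot, LinearMap.ker_eq_bot']
    exact fun Z hZ => lyapunov_eq_zero hF (by simpa [T] using hZ)
  obtain ⟨Z, hZ⟩ := LinearMap.injective_iff_surjective.1 hinj (-W)
  exact ⟨Z, by rw [add_eq_zero_iff_eq_neg, ← hZ]; simp [T]⟩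

lemma lyapunov_transpose {F Z W : Matrix (Fin p) (Fin p) ℝ} (hF : IsHurwitz F) (hW : Wᵀ = W)
    (h : F * Z + Z * Fᵀ + W = 0) : Zᵀ = Z := by
  refine lyapunov_unique hF (W := W) ?_ h
  have := congrArg Matrix.transpose h
  simp only [Matrix.transpose_add, Matrix.transpose_mul, Matrix.transpose_transpose, hW,
    Matrix.transpose_zero] at this
  rw [← this]; abel

lemma exists_lyapunov_posSemidef {F W : Matrix (Fin p) (Fin p) ℝ} (hF : IsHurwitz F)
    (hW : W.PosSemidef) : ∃ Z, Z.PosSemidef ∧ F * Z + Z * Fᵀ + W = 0 := by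
  obtain ⟨Z, hZ⟩ := exists_lyapunov hF W
  exact ⟨Z, lyapunov_posSemidef hF (lyapunov_transpose hF hW.isSymm hZ) hW hZ, hZ⟩

/-- The integral `∫₀^∞ e^{tF} W e^{tFᵀ} dt` is the solution of the Lyapunov equation. The integrand
is integrable because its entries are bounded by its trace, the derivative of a bounded monotone
function. -/
lemma integral_exp_eq {F Z W : Matrix (Fin p) (Fin p) ℝ} (hF : IsHurwitz F) (hW : W.PosSemidef)
    (h : F * Z + Z * Fᵀ + W = 0) (i j : Fin p) :
    ∫ t in Set.Ioi (0 : ℝ), (exp (t • F) * W * exp (t • Fᵀ)) i j = Z i j := by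
  have hpsd : ∀ t : ℝ, (exp (t • F) * W * exp (t • Fᵀ)).PosSemidef := fun t => by
    rw [exp_smul_transpose]; exact hW.congr_transpose _
  have htr : IntegrableOn (fun t : ℝ => (exp (t • F) * W * exp (t • Fᵀ)).trace) (Set.Ioi 0) :=
    integrableOn_Ioi_deriv_of_nonneg'
      (fun t _ => hasDerivAt_linear_exp (Matrix.traceLinearMap (Fin p) ℝ ℝ) h t)
      (fun t _ => (hpsd t).trace_nonneg) (tendsto_linear_exp (Matrix.traceLinearMap _ _ _) hF Z)
  have hcont : Continuous fun t : ℝ => (exp (t • F) * W * exp (t • Fᵀ)) i j := by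
    have h1 : Continuous fun t : ℝ => exp (t • F) * W * exp (t • Fᵀ) :=
      continuous_iff_continuousAt.2 fun t => (hasDerivAt_exp_mul_mul_exp F W t).continuousAt
    exact h1.matrix_elem i j
  have hint : IntegrableOn (fun t : ℝ => (exp (t • F) * W * exp (t • Fᵀ)) i j) (Set.Ioi 0) := by
    refine htr.mono' hcont.aestronglyMeasurable (Eventually.of_forall fun t => ?_)
    refine le_trans (le_of_sq_le_sq ?_ (norm_nonneg _)) (norm_le_trace (hpsd t))
    rw [norm_sq_eq_sum, Real.norm_eq_abs, sq_abs]
    exact (Finset.single_le_sum (f := fun j => (exp (t • F) * W * exp (t • Fᵀ)) i j ^ 2)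
      (fun _ _ => sq_nonneg _) (Finset.mem_univ j)).trans
      (Finset.single_le_sum (f := fun i => ∑ j, (exp (t • F) * W * exp (t • Fᵀ)) i j ^ 2)
      (fun _ _ => Finset.sum_nonneg fun _ _ => sq_nonneg _) (Finset.mem_univ i))
  have := integral_Ioi_of_hasDerivAt_of_tendsto'
    (fun t _ => hasDerivAt_linear_exp (entryLin i j) h t) hint (tendsto_linear_exp _ hF Z)
  simpa using this

/-- Comparison for Lyapunov equations: if `W ≥ l > 0`, then the solution `Z` with right-hand side
`C` satisfies `-(‖C‖ / l) X ≤ Z ≤ (‖C‖ / l) X`, where `X` is the solution with right-hand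
side `W`. -/
lemma norm_le_of_lyapunov {F X Z W C : Matrix (Fin p) (Fin p) ℝ} {l : ℝ} (hF : IsHurwitz F)
    (hl : 0 < l) (hWs : Wᵀ = W) (hW : (W - l • (1 : Matrix (Fin p) (Fin p) ℝ)).PosSemidef)
    (hX : F * X + X * Fᵀ + W = 0) (hC : Cᵀ = C) (hZ : F * Z + Z * Fᵀ + C = 0) :
    ‖Z‖ ≤ ‖C‖ / l * X.trace := by
  have hXs := lyapunov_transpose hF hWs hX
  have hZs := lyapunov_transpose hF hC hZ
  have hk : 0 ≤ ‖C‖ / l := by positivity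
  have hWk : ((‖C‖ / l) • W - ‖C‖ • (1 : Matrix (Fin p) (Fin p) ℝ)).PosSemidef := by
    have := hW.smul hk
    rwa [smul_sub, smul_smul, div_mul_cancel₀ _ hl.ne'] at this
  have hX' : X.PosSemidef := by
    refine lyapunov_posSemidef hF hXs ?_ hX
    simpa using hW.add (Matrix.PosSemidef.one.smul hl.le)
  have heq : ∀ s : ℝ, F * ((‖C‖ / l) • X + s • Z) + ((‖C‖ / l) • X + s • Z) * Fᵀ
      + ((‖C‖ / l) • W + s • C) = 0 := by
    intro s
    have : (‖C‖ / l) • (F * X + X * Fᵀ + W) + s • (F * Z + Z * Fᵀ + C) = 0 := by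
      rw [hX, hZ]; simp
    rw [← this]
    simp only [Matrix.mul_add, Matrix.add_mul, Matrix.mul_smul, Matrix.smul_mul, smul_add]
    abel
  rw [← smul_eq_mul, ← Matrix.trace_smul]
  refine norm_le_trace_of_sandwich hZs (hX'.smul hk) ?_ ?_
  · have h1 := hWk.add (smul_one_sub_posSemidef hC le_rfl)
    have := lyapunov_posSemidef hF (by simp [hXs, hZs]) (by convert h1 using 1; module) (heq (-1))
    simpa [sub_eq_add_neg] using this
  · have h1 := hWk.add (smul_one_add_posSemidef hC le_rfl)
    have := lyapunov_posSemidef hF (by simp [hXs, hZs]) (by convert h1 using 1; module) (heq 1)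
    simpa using this

/-- A matrix with a positive semidefinite Lyapunov certificate is Hurwitz: for an eigenvector
`x + i y` of `Fᵀ` with eigenvalue `z`,
`2 Re z (xᵀ X x + yᵀ X y) = -(xᵀ W x + yᵀ W y) < 0`. -/
lemma isHurwitz_of_lyapunov {F X W : Matrix (Fin p) (Fin p) ℝ} (hX : X.PosSemidef)
    (hW : W.PosDef) (h : F * X + X * Fᵀ + W = 0) : IsHurwitz F := by
  intro z hz
  rw [Matrix.mem_spectrum_iff_isRoot_charpoly, ← Matrix.charpoly_transpose,
    ← Matrix.mem_spectrum_iff_isRoot_charpoly, ← Matrix.spectrum_toLin',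
    ← Module.End.hasEigenvalue_iff_mem_spectrum] at hz
  obtain ⟨v, hv⟩ := hz.exists_hasEigenvector
  have hFv : (F.map (algebraMap ℝ ℂ))ᵀ *ᵥ v = z • v := by simpa using hv.apply_eq_smul
  set x : Fin p → ℝ := fun i => (v i).re with hx
  set y : Fin p → ℝ := fun i => (v i).im with hy
  have hFx : Fᵀ *ᵥ x = z.re • x - z.im • y := by
    ext i
    have := congrArg Complex.re (congrFun hFv i)
    simpa [Matrix.mulVec, dotProduct, hx, hy] using this
  have hFy : Fᵀ *ᵥ y = z.re • y + z.im • x := by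
    ext i
    have := congrArg Complex.im (congrFun hFv i)
    simpa [Matrix.mulVec, dotProduct, hx, hy] using this
  have hsym : ∀ u w : Fin p → ℝ, u ⬝ᵥ (X *ᵥ w) = w ⬝ᵥ (X *ᵥ u) := fun u w => by
    rw [dotProduct_mulVec, ← Matrix.mulVec_transpose, hX.isSymm, dotProduct_comm]
  have hquad : ∀ u : Fin p → ℝ, 2 * (u ⬝ᵥ (X *ᵥ (Fᵀ *ᵥ u))) = -(u ⬝ᵥ (W *ᵥ u)) := fun u => by
    have h1 : u ⬝ᵥ ((F * X) *ᵥ u) = u ⬝ᵥ (X *ᵥ (Fᵀ *ᵥ u)) := by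
      rw [← Matrix.mulVec_mulVec, dotProduct_mulVec, ← Matrix.mulVec_transpose, hsym]
    have h2 : u ⬝ᵥ ((F * X + X * Fᵀ + W) *ᵥ u) = 0 := by rw [h]; simp
    rw [Matrix.add_mulVec, Matrix.add_mulVec, dotProduct_add, dotProduct_add, h1,
      ← Matrix.mulVec_mulVec] at h2
    linarith
  have hqx := hquad x
  have hqy := hquad y
  rw [hFx, Matrix.mulVec_sub, Matrix.mulVec_smul, Matrix.mulVec_smul, dotProduct_sub,
    dotProduct_smul, dotProduct_smul, smul_eq_mul, smul_eq_mul] at hqx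
  rw [hFy, Matrix.mulVec_add, Matrix.mulVec_smul, Matrix.mulVec_smul, dotProduct_add,
    dotProduct_smul, dotProduct_smul, smul_eq_mul, smul_eq_mul, hsym y x] at hqy
  have hXx : 0 ≤ x ⬝ᵥ (X *ᵥ x) := by simpa using hX.dotProduct_mulVec_nonneg x
  have hXy : 0 ≤ y ⬝ᵥ (X *ᵥ y) := by simpa using hX.dotProduct_mulVec_nonneg y
  have hWx : 0 ≤ x ⬝ᵥ (W *ᵥ x) := by simpa using hW.posSemidef.dotProduct_mulVec_nonneg x
  have hWy : 0 ≤ y ⬝ᵥ (W *ᵥ y) := by simpa using hW.posSemidef.dotProduct_mulVec_nonneg y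
  have hpos : 0 < x ⬝ᵥ (W *ᵥ x) + y ⬝ᵥ (W *ᵥ y) := by
    by_cases hx0 : x = 0
    · have hy0 : y ≠ 0 := fun hy0 => hv.2 <| by
        ext i
        exact Complex.ext (congrFun hx0 i) (congrFun hy0 i)
      have := hW.dotProduct_mulVec_pos hy0
      simp only [star_trivial] at this
      linarith
    · have := hW.dotProduct_mulVec_pos hx0
      simp only [star_trivial] at this
      linarith
  by_contra hre
  push Not at hre
  nlinarith [mul_nonneg hre hXx, mul_nonneg hre hXy]

/-- Duality of the Lyapunov equations of `F` and `Fᵀ`. -/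
lemma lyapunov_trace_duality {F X P W V : Matrix (Fin p) (Fin p) ℝ}
    (hX : F * X + X * Fᵀ + W = 0) (hP : Fᵀ * P + P * F + V = 0) :
    (V * X).trace = (P * W).trace := by
  rw [eq_neg_of_add_eq_zero_right hP, eq_neg_of_add_eq_zero_right hX, Matrix.neg_mul,
    Matrix.mul_neg, Matrix.trace_neg, Matrix.trace_neg, Matrix.add_mul, Matrix.mul_add,
    Matrix.trace_add, Matrix.trace_add, Matrix.mul_assoc Fᵀ, Matrix.trace_mul_comm Fᵀ,
    Matrix.mul_assoc, Matrix.mul_assoc, add_comm]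

end Lyapunov

namespace Data

variable {n m : ℕ}

/-! ### The two Gramians of a stabilizing gain -/

/-- The standing assumptions: positive dimensions and positive definite weights. -/
structure IsPositive (S : Data n m) : Prop where
  n_pos : 0 < n
  m_pos : 0 < m
  Q_posDef : S.Q.PosDef
  R_posDef : S.R.PosDef
  Ω_posDef : S.Ω.PosDef

/-- The weight `Q + Kᵀ R K` of the state in the closed loop. -/
def weight (S : Data n m) (K : Matrix (Fin m) (Fin n) ℝ) : Matrix (Fin n) (Fin n) ℝ :=
  S.Q + Kᵀ * S.R * K

open NormedSpace in
/-- The cost matrix `P(K) = ∫₀^∞ e^{(A - BK)ᵀt} (Q + Kᵀ R K) e^{(A - BK)t} dt` (entrywise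
integral). -/
noncomputable def P (S : Data n m) (K : Matrix (Fin m) (Fin n) ℝ) : Matrix (Fin n) (Fin n) ℝ :=
  Matrix.of fun i j => ∫ t in Set.Ioi (0 : ℝ),
    (exp (t • (S.closedLoop K)ᵀ) * S.weight K * exp (t • S.closedLoop K)) i j

/-- The factor `E(K) = R K - Bᵀ P(K)` of the gradient `2 E(K) X(K)`. -/
noncomputable def E (S : Data n m) (K : Matrix (Fin m) (Fin n) ℝ) : Matrix (Fin m) (Fin n) ℝ :=
  S.R * K - S.Bᵀ * S.P K

/-- The constant `2 λ_min(R) λ_min(Q) ν² / a³`, for which the Polyak–Łojasiewicz inequality holds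
without any assumption on the open loop. -/
noncomputable def plConst (S : Data n m) (a : ℝ) : ℝ :=
  2 * lambdaMin S.R * lambdaMin S.Q * S.nu ^ 2 / a ^ 3

variable {S : Data n m} {K K₁ K₂ : Matrix (Fin m) (Fin n) ℝ} {a : ℝ}

namespace IsPositive

lemma lambdaMin_Q_pos (hS : S.IsPositive) : 0 < lambdaMin S.Q := lambdaMin_pos hS.n_pos hS.Q_posDef

lemma lambdaMin_R_pos (hS : S.IsPositive) : 0 < lambdaMin S.R := lambdaMin_pos hS.m_pos hS.R_posDef

lemma lambdaMin_Ω_pos (hS : S.IsPositive) : 0 < lambdaMin S.Ω := lambdaMin_pos hS.n_pos hS.Ω_posDef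

lemma R_transpose (hS : S.IsPositive) : S.Rᵀ = S.R := hS.R_posDef.posSemidef.isSymm

lemma Ω_transpose (hS : S.IsPositive) : S.Ωᵀ = S.Ω := hS.Ω_posDef.posSemidef.isSymm

lemma control_posSemidef (hS : S.IsPositive) (K : Matrix (Fin m) (Fin n) ℝ) :
    (Kᵀ * S.R * K).PosSemidef := by
  simpa using hS.R_posDef.posSemidef.congr_transpose Kᵀ

lemma weight_posSemidef (hS : S.IsPositive) (K : Matrix (Fin m) (Fin n) ℝ) :
    (S.weight K).PosSemidef :=
  hS.Q_posDef.posSemidef.add (hS.control_posSemidef K)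

lemma weight_sub_posSemidef (hS : S.IsPositive) (K : Matrix (Fin m) (Fin n) ℝ) :
    (S.weight K - lambdaMin S.Q • (1 : Matrix (Fin n) (Fin n) ℝ)).PosSemidef := by
  have := (lambdaMin_spec hS.n_pos hS.Q_posDef.posSemidef.isSymm).1.add (hS.control_posSemidef K)
  convert this using 1
  rw [weight]; abel

lemma Ω_sub_posSemidef (hS : S.IsPositive) :
    (S.Ω - lambdaMin S.Ω • (1 : Matrix (Fin n) (Fin n) ℝ)).PosSemidef :=
  (lambdaMin_spec hS.n_pos hS.Ω_transpose).1

/-- `X(K)` is determined by its Lyapunov equation. -/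
lemma X_eq (hS : S.IsPositive) (hK : K ∈ S.stabilizing) {Z : Matrix (Fin n) (Fin n) ℝ}
    (h : S.closedLoop K * Z + Z * (S.closedLoop K)ᵀ + S.Ω = 0) : S.X K = Z := by
  ext i j
  exact integral_exp_eq hK hS.Ω_posDef.posSemidef h i j

lemma X_lyapunov (hS : S.IsPositive) (hK : K ∈ S.stabilizing) :
    S.closedLoop K * S.X K + S.X K * (S.closedLoop K)ᵀ + S.Ω = 0 := by
  obtain ⟨Z, -, h⟩ := exists_lyapunov_posSemidef hK hS.Ω_posDef.posSemidef
  rwa [hS.X_eq hK h]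

lemma X_posSemidef (hS : S.IsPositive) (hK : K ∈ S.stabilizing) : (S.X K).PosSemidef := by
  obtain ⟨Z, hZ, h⟩ := exists_lyapunov_posSemidef hK hS.Ω_posDef.posSemidef
  rwa [hS.X_eq hK h]

lemma P_eq (hS : S.IsPositive) (hK : K ∈ S.stabilizing) {Z : Matrix (Fin n) (Fin n) ℝ}
    (h : (S.closedLoop K)ᵀ * Z + Z * S.closedLoop K + S.weight K = 0) : S.P K = Z := by
  ext i j
  have := integral_exp_eq (IsHurwitz.transpose hK) (hS.weight_posSemidef K)
    (Z := Z) (by rwa [Matrix.transpose_transpose]) i j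
  rwa [Matrix.transpose_transpose] at this

lemma P_lyapunov (hS : S.IsPositive) (hK : K ∈ S.stabilizing) :
    (S.closedLoop K)ᵀ * S.P K + S.P K * S.closedLoop K + S.weight K = 0 := by
  obtain ⟨Z, -, h⟩ := exists_lyapunov_posSemidef (IsHurwitz.transpose hK) (hS.weight_posSemidef K)
  rw [Matrix.transpose_transpose] at h
  rwa [hS.P_eq hK h]

lemma P_posSemidef (hS : S.IsPositive) (hK : K ∈ S.stabilizing) : (S.P K).PosSemidef := by
  obtain ⟨Z, hZ, h⟩ := exists_lyapunov_posSemidef (IsHurwitz.transpose hK)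
    (hS.weight_posSemidef K)
  rw [Matrix.transpose_transpose] at h
  rwa [hS.P_eq hK h]

lemma obj_eq_trace_P_mul_Ω (hS : S.IsPositive) (hK : K ∈ S.stabilizing) :
    S.obj K = (S.P K * S.Ω).trace :=
  lyapunov_trace_duality (hS.X_lyapunov hK) (hS.P_lyapunov hK)

/-! ### Bounds on a sublevel set -/

lemma mul_trace_X_le (hS : S.IsPositive) (hK : K ∈ S.stabilizing) :
    lambdaMin S.Q * (S.X K).trace ≤ S.obj K :=
  mul_trace_le_trace_mul (hS.weight_sub_posSemidef K) (hS.X_posSemidef hK)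

lemma mul_trace_P_le (hS : S.IsPositive) (hK : K ∈ S.stabilizing) :
    lambdaMin S.Ω * (S.P K).trace ≤ S.obj K := by
  rw [hS.obj_eq_trace_P_mul_Ω hK, Matrix.trace_mul_comm]
  exact mul_trace_le_trace_mul hS.Ω_sub_posSemidef (hS.P_posSemidef hK)

lemma Ω_ne_zero (hS : S.IsPositive) : S.Ω ≠ 0 := by
  intro h
  have := hS.Ω_posDef.diag_pos (i := ⟨0, hS.n_pos⟩)
  simp [h] at this

/-- Otherwise `X(K) = 0`, which contradicts the Lyapunov equation. -/
lemma obj_pos (hS : S.IsPositive) (hK : K ∈ S.stabilizing) : 0 < S.obj K := by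
  by_contra h
  have h1 := hS.mul_trace_X_le hK
  have h2 := norm_le_trace (hS.X_posSemidef hK)
  have h3 := hS.lambdaMin_Q_pos
  have h4 : (S.X K).trace ≤ 0 := by nlinarith
  have hX : S.X K = 0 := norm_le_zero_iff.1 (h2.trans h4)
  have := hS.X_lyapunov hK
  exact hS.Ω_ne_zero (by simpa [hX] using this)

lemma level_pos (hS : S.IsPositive) (hK : K ∈ S.sublevel a) : 0 < a :=
  (hS.obj_pos hK.1).trans_le hK.2

lemma trace_X_le (hS : S.IsPositive) (hK : K ∈ S.sublevel a) :
    (S.X K).trace ≤ a / lambdaMin S.Q := by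
  rw [le_div_iff₀ hS.lambdaMin_Q_pos, mul_comm]
  exact (hS.mul_trace_X_le hK.1).trans hK.2

lemma norm_X_le (hS : S.IsPositive) (hK : K ∈ S.sublevel a) : ‖S.X K‖ ≤ a / lambdaMin S.Q :=
  (norm_le_trace (hS.X_posSemidef hK.1)).trans (hS.trace_X_le hK)

lemma trace_P_le (hS : S.IsPositive) (hK : K ∈ S.sublevel a) :
    (S.P K).trace ≤ a / lambdaMin S.Ω := by
  rw [le_div_iff₀ hS.lambdaMin_Ω_pos, mul_comm]
  exact (hS.mul_trace_P_le hK.1).trans hK.2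

lemma norm_P_le (hS : S.IsPositive) (hK : K ∈ S.sublevel a) : ‖S.P K‖ ≤ a / lambdaMin S.Ω :=
  (norm_le_trace (hS.P_posSemidef hK.1)).trans (hS.trace_P_le hK)

lemma mul_norm_sq_le_trace_control (hS : S.IsPositive) (K : Matrix (Fin m) (Fin n) ℝ) :
    lambdaMin S.R * ‖K‖ ^ 2 ≤ (Kᵀ * S.R * K).trace := by
  have := mul_trace_le_trace_mul (lambdaMin_spec hS.m_pos hS.R_transpose).1
    (posSemidef_transpose_mul_self Kᵀ)
  rw [Matrix.transpose_transpose, trace_mul_transpose_self] at this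
  rwa [Matrix.mul_assoc, Matrix.trace_mul_comm, Matrix.mul_assoc]

/-- The gain is controlled by any lower bound of `X(K)`. -/
lemma mul_norm_sq_le_obj (hS : S.IsPositive) (hK : K ∈ S.stabilizing) {x : ℝ} (hx : 0 ≤ x)
    (hX : (S.X K - x • (1 : Matrix (Fin n) (Fin n) ℝ)).PosSemidef) :
    x * (lambdaMin S.R * ‖K‖ ^ 2) ≤ S.obj K := by
  have h1 := mul_trace_le_trace_mul hX (hS.control_posSemidef K)
  have h2 := trace_mul_nonneg hS.Q_posDef.posSemidef (hS.X_posSemidef hK)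
  have h3 : S.obj K = (S.Q * S.X K).trace + (S.X K * (Kᵀ * S.R * K)).trace := by
    rw [obj, Matrix.add_mul, Matrix.trace_add, Matrix.trace_mul_comm (S.X K)]
  have := mul_le_mul_of_nonneg_left (hS.mul_norm_sq_le_trace_control K) hx
  linarith

/-- If both spectral norms vanished, then `X(K)` would be annihilated by `A - B K`, and `Ω = 0`. -/
lemma nu_base_pos (hS : S.IsPositive) (hne : S.stabilizing.Nonempty) :
    0 < specNorm S.A / √(lambdaMin S.Q) + specNorm S.B / √(lambdaMin S.R) := by
  obtain ⟨K, hK⟩ := hne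
  have hq := Real.sqrt_pos.2 hS.lambdaMin_Q_pos
  have hr := Real.sqrt_pos.2 hS.lambdaMin_R_pos
  have hA0 := specNorm_nonneg S.A
  have hB0 := specNorm_nonneg S.B
  by_contra h
  have h1 : 0 ≤ specNorm S.A / √(lambdaMin S.Q) := by positivity
  have h2 : 0 ≤ specNorm S.B / √(lambdaMin S.R) := by positivity
  have hA : specNorm S.A = 0 := by
    have : specNorm S.A / √(lambdaMin S.Q) = 0 := by linarith
    simpa [hq.ne'] using this
  have hB : specNorm S.B = 0 := by
    have : specNorm S.B / √(lambdaMin S.R) = 0 := by linarith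
    simpa [hr.ne'] using this
  have hAX : S.A * S.X K = 0 :=
    norm_le_zero_iff.1 ((norm_mul_le_specNorm_mul _ _).trans (by rw [hA, zero_mul]))
  have hBX : S.B * (K * S.X K) = 0 :=
    norm_le_zero_iff.1 ((norm_mul_le_specNorm_mul _ _).trans (by rw [hB, zero_mul]))
  have hFX : S.closedLoop K * S.X K = 0 := by
    rw [closedLoop, Matrix.sub_mul, hAX, Matrix.mul_assoc, hBX, sub_zero]
  have hXF : S.X K * (S.closedLoop K)ᵀ = 0 := by
    have := congrArg Matrix.transpose hFX
    rwa [Matrix.transpose_mul, (hS.X_posSemidef hK).isSymm, Matrix.transpose_zero] at this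
  have := hS.X_lyapunov hK
  rw [hFX, hXF, zero_add, zero_add] at this
  exact hS.Ω_ne_zero this

lemma nu_pos (hS : S.IsPositive) (hne : S.stabilizing.Nonempty) : 0 < S.nu := by
  have := hS.nu_base_pos hne
  have := hS.lambdaMin_Ω_pos
  rw [nu]; positivity

/-- The Lyapunov equation, tested with a unit eigenvector for the smallest eigenvalue of `X(K)`. -/
lemma lambdaMin_Ω_le (hS : S.IsPositive) (hK : K ∈ S.stabilizing) :
    0 ≤ lambdaMin (S.X K) ∧ lambdaMin (S.X K) ≤ (S.X K).trace ∧
      lambdaMin S.Ω ≤ 2 * lambdaMin (S.X K) * (specNorm S.A + specNorm S.B * ‖K‖) := by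
  obtain ⟨-, V, hV, hXV⟩ := lambdaMin_spec hS.n_pos (hS.X_posSemidef hK).isSymm
  set x := lambdaMin (S.X K) with hx
  have hXs := (hS.X_posSemidef hK).isSymm
  have hVX : Vᵀ * S.X K = x • Vᵀ := by
    have := congrArg Matrix.transpose hXV
    rwa [Matrix.transpose_mul, hXs, Matrix.transpose_smul] at this
  have hVV : (Vᵀ * V).trace = 1 := by rw [trace_transpose_mul_self, hV]; norm_num
  have hxV : (Vᵀ * (S.X K * V)).trace = x := by
    rw [hXV, Matrix.mul_smul, Matrix.trace_smul, hVV]; simp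
  have hx0 : 0 ≤ x := by
    rw [← hxV, ← Matrix.mul_assoc]
    simpa using ((hS.X_posSemidef hK).congr_transpose Vᵀ).trace_nonneg
  refine ⟨hx0, ?_, ?_⟩
  · rw [← hxV]
    calc (Vᵀ * (S.X K * V)).trace ≤ ‖Vᵀ‖ * ‖S.X K * V‖ := trace_mul_le _ _
      _ ≤ ‖Vᵀ‖ * (‖S.X K‖ * ‖V‖) := by gcongr; exact Matrix.frobenius_norm_mul _ _
      _ = ‖S.X K‖ := by rw [Matrix.frobenius_norm_transpose, hV]; ring
      _ ≤ _ := norm_le_trace (hS.X_posSemidef hK)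
  · have h1 : lambdaMin S.Ω ≤ (Vᵀ * (S.Ω * V)).trace := by
      have := mul_trace_le_trace_mul hS.Ω_sub_posSemidef (posSemidef_transpose_mul_self Vᵀ)
      rw [Matrix.transpose_transpose, trace_mul_transpose_self, hV, ← Matrix.mul_assoc,
        Matrix.trace_mul_comm] at this
      simpa using this
    have h2 : (Vᵀ * (S.Ω * V)).trace = -(2 * x * (Vᵀ * (S.closedLoop K * V)).trace) := by
      have e1 : (Vᵀ * (S.closedLoop K * S.X K * V)).trace
          = x * (Vᵀ * (S.closedLoop K * V)).trace := by
        rw [Matrix.mul_assoc, hXV, Matrix.mul_smul, Matrix.mul_smul, Matrix.trace_smul, smul_eq_mul]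
      have e2 : (Vᵀ * (S.X K * (S.closedLoop K)ᵀ * V)).trace
          = x * (Vᵀ * (S.closedLoop K * V)).trace := by
        rw [← Matrix.trace_transpose, ← e1]
        simp only [Matrix.transpose_mul, Matrix.transpose_transpose, hXs, Matrix.mul_assoc]
      have e3 : (Vᵀ * ((S.closedLoop K * S.X K + S.X K * (S.closedLoop K)ᵀ + S.Ω) * V)).trace
          = 0 := by rw [hS.X_lyapunov hK]; simp
      rw [Matrix.add_mul, Matrix.add_mul, Matrix.mul_add, Matrix.mul_add, Matrix.trace_add,
        Matrix.trace_add, e1, e2] at e3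
      linarith
    have h3 : -(Vᵀ * (S.closedLoop K * V)).trace ≤ specNorm S.A + specNorm S.B * ‖K‖ := by
      calc -(Vᵀ * (S.closedLoop K * V)).trace ≤ |(Vᵀ * (S.closedLoop K * V)).trace| :=
            neg_le_abs _
        _ ≤ ‖Vᵀ‖ * ‖S.closedLoop K * V‖ := abs_trace_mul_le _ _
        _ = ‖S.A * V - S.B * (K * V)‖ := by
            rw [Matrix.frobenius_norm_transpose, hV, one_mul, closedLoop, Matrix.sub_mul,
              Matrix.mul_assoc]
        _ ≤ ‖S.A * V‖ + ‖S.B * (K * V)‖ := norm_sub_le _ _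
        _ ≤ specNorm S.A * ‖V‖ + specNorm S.B * (‖K‖ * ‖V‖) :=
            add_le_add (norm_mul_le_specNorm_mul _ _) ((norm_mul_le_specNorm_mul _ _).trans
              (mul_le_mul_of_nonneg_left (Matrix.frobenius_norm_mul _ _) (specNorm_nonneg _)))
        _ = _ := by rw [hV]; ring
    have := mul_le_mul_of_nonneg_left h3 (mul_nonneg zero_le_two hx0)
    linarith

/-- The smallest eigenvalue of `X(K)` is at least `ν / a` on the sublevel set. -/
lemma nu_div_le (hS : S.IsPositive) (hK : K ∈ S.sublevel a) :
    S.nu / a ≤ lambdaMin (S.X K) := by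
  obtain ⟨hx0, hxtr, hΩ⟩ := hS.lambdaMin_Ω_le hK.1
  have ha := hS.level_pos hK
  have hK2 := (hS.mul_norm_sq_le_obj hK.1 hx0
    (lambdaMin_spec hS.n_pos (hS.X_posSemidef hK.1).isSymm).1).trans hK.2
  have hQ2 := (mul_le_mul_of_nonneg_left hxtr hS.lambdaMin_Q_pos.le).trans
    ((hS.mul_trace_X_le hK.1).trans hK.2)
  have hg := hS.nu_base_pos ⟨K, hK.1⟩
  set x := lambdaMin (S.X K)
  set g := specNorm S.A / √(lambdaMin S.Q) + specNorm S.B / √(lambdaMin S.R) with hgdef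
  have hq := Real.sqrt_pos.2 hS.lambdaMin_Q_pos
  have hr := Real.sqrt_pos.2 hS.lambdaMin_R_pos
  have hA0 := specNorm_nonneg S.A
  have hB0 := specNorm_nonneg S.B
  -- Both `√x` and `√x ‖K‖` are at most multiples of `√a`.
  have h1 : √x ≤ √a / √(lambdaMin S.Q) := by
    rw [le_div_iff₀ hq, ← Real.sqrt_mul hx0]
    exact Real.sqrt_le_sqrt (by linarith)
  have h2 : √x * ‖K‖ ≤ √a / √(lambdaMin S.R) := by
    rw [le_div_iff₀ hr]
    refine Real.le_sqrt_of_sq_le ?_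
    rw [mul_pow, mul_pow, Real.sq_sqrt hx0, Real.sq_sqrt hS.lambdaMin_R_pos.le]
    linarith
  have h3 : lambdaMin S.Ω ≤ 2 * √x * √a * g := by
    calc lambdaMin S.Ω ≤ 2 * x * (specNorm S.A + specNorm S.B * ‖K‖) := hΩ
      _ = 2 * √x * (specNorm S.A * √x + specNorm S.B * (√x * ‖K‖)) := by
          nth_rw 1 [← Real.mul_self_sqrt hx0]; ring
      _ ≤ 2 * √x * (specNorm S.A * (√a / √(lambdaMin S.Q))
            + specNorm S.B * (√a / √(lambdaMin S.R))) := by gcongr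
      _ = 2 * √x * √a * g := by rw [hgdef]; ring
  have h4 : lambdaMin S.Ω ^ 2 ≤ 4 * x * a * g ^ 2 := by
    calc lambdaMin S.Ω ^ 2 ≤ (2 * √x * √a * g) ^ 2 :=
          pow_le_pow_left₀ hS.lambdaMin_Ω_pos.le h3 2
      _ = 4 * √x ^ 2 * √a ^ 2 * g ^ 2 := by ring
      _ = _ := by rw [Real.sq_sqrt hx0, Real.sq_sqrt ha.le]
  rw [div_le_iff₀ ha, nu, ← hgdef, ← div_eq_mul_inv, div_le_iff₀ (by positivity)]
  linarith

lemma X_sub_posSemidef (hS : S.IsPositive) (hK : K ∈ S.sublevel a) :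
    (S.X K - (S.nu / a) • (1 : Matrix (Fin n) (Fin n) ℝ)).PosSemidef := by
  have h1 := (lambdaMin_spec hS.n_pos (hS.X_posSemidef hK.1).isSymm).1
  have h2 := Matrix.PosSemidef.one (n := Fin n) (R := ℝ) |>.smul (sub_nonneg.2 (hS.nu_div_le hK))
  convert h1.add h2 using 1
  module

lemma norm_le_of_mem_sublevel (hS : S.IsPositive) (hK : K ∈ S.sublevel a) :
    ‖K‖ ≤ a / √(S.nu * lambdaMin S.R) := by
  have ha := hS.level_pos hK
  have hν := hS.nu_pos ⟨K, hK.1⟩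
  have hr := hS.lambdaMin_R_pos
  rw [le_div_iff₀ (by positivity)]
  refine le_of_sq_le_sq ?_ ha.le
  have h := (hS.mul_norm_sq_le_obj hK.1 (by positivity) (hS.X_sub_posSemidef hK)).trans hK.2
  rw [div_mul_eq_mul_div, div_le_iff₀ ha] at h
  rw [mul_pow, Real.sq_sqrt (by positivity)]
  linarith

lemma nu_le (hS : S.IsPositive) (hK : K ∈ S.sublevel a) : S.nu * lambdaMin S.Q ≤ a ^ 2 := by
  have ha := hS.level_pos hK
  have h := (hS.nu_div_le hK).trans ((hS.lambdaMin_Ω_le hK.1).2.1.trans (hS.trace_X_le hK))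
  rw [div_le_div_iff₀ ha hS.lambdaMin_Q_pos] at h
  linarith

/-! ### Exact difference formulas -/

lemma E_transpose (hS : S.IsPositive) (hK : K ∈ S.stabilizing) :
    (S.E K)ᵀ = Kᵀ * S.R - S.P K * S.B := by
  simp [E, Matrix.transpose_sub, Matrix.transpose_mul, hS.R_transpose, (hS.P_posSemidef hK).isSymm]

/-- The exact second order expansion of the objective. -/
lemma obj_sub_obj (hS : S.IsPositive) (h₁ : K₁ ∈ S.stabilizing) (h₂ : K₂ ∈ S.stabilizing) :
    S.obj K₁ - S.obj K₂ = (((K₁ - K₂)ᵀ * S.R * (K₁ - K₂) + (K₁ - K₂)ᵀ * S.E K₂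
      + (S.E K₂)ᵀ * (K₁ - K₂)) * S.X K₁).trace := by
  have hd := lyapunov_trace_duality (P := S.P K₂)
    (V := -((S.closedLoop K₁)ᵀ * S.P K₂ + S.P K₂ * S.closedLoop K₁)) (hS.X_lyapunov h₁) (by abel)
  have hP := hS.P_lyapunov h₂
  have hid : (K₁ - K₂)ᵀ * S.R * (K₁ - K₂) + (K₁ - K₂)ᵀ * S.E K₂ + (S.E K₂)ᵀ * (K₁ - K₂)
      = S.weight K₁ + ((S.closedLoop K₁)ᵀ * S.P K₂ + S.P K₂ * S.closedLoop K₁)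
        - ((S.closedLoop K₂)ᵀ * S.P K₂ + S.P K₂ * S.closedLoop K₂ + S.weight K₂) := by
    rw [hS.E_transpose h₂]
    simp only [E, weight, closedLoop, Matrix.transpose_sub, Matrix.transpose_mul, Matrix.mul_sub,
      Matrix.sub_mul, Matrix.mul_assoc]
    abel
  rw [hid, hP, sub_zero, Matrix.add_mul, Matrix.trace_add, hS.obj_eq_trace_P_mul_Ω h₂, ← hd,
    Matrix.neg_mul, Matrix.trace_neg, sub_neg_eq_add]
  rfl

lemma norm_X_sub_le (hS : S.IsPositive) (h₁ : K₁ ∈ S.stabilizing) (h₂ : K₂ ∈ S.stabilizing) :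
    ‖S.X K₁ - S.X K₂‖
      ≤ 2 * (specNorm S.B * ‖K₁ - K₂‖ * ‖S.X K₂‖) / lambdaMin S.Ω * (S.X K₁).trace := by
  set D := K₁ - K₂ with hD
  set N := S.B * (D * S.X K₂) with hN
  have hX₂s := (hS.X_posSemidef h₂).isSymm
  have hZ : S.closedLoop K₁ * (S.X K₁ - S.X K₂) + (S.X K₁ - S.X K₂) * (S.closedLoop K₁)ᵀ
      + -(N + Nᵀ) = 0 := by
    have e1 := hS.X_lyapunov h₁
    have e2 := hS.X_lyapunov h₂
    rw [← sub_self (0 : Matrix (Fin n) (Fin n) ℝ)]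
    nth_rw 1 [← e1]
    rw [← e2]
    simp only [hN, hD, closedLoop, Matrix.transpose_sub, Matrix.transpose_mul, Matrix.mul_sub,
      Matrix.sub_mul, Matrix.mul_assoc, hX₂s]
    abel
  have h := norm_le_of_lyapunov h₁ hS.lambdaMin_Ω_pos hS.Ω_transpose hS.Ω_sub_posSemidef
    (hS.X_lyapunov h₁) (by simp [add_comm]) hZ
  refine h.trans ?_
  have hl := hS.lambdaMin_Ω_pos
  have htr := (hS.X_posSemidef h₁).trace_nonneg
  gcongr
  have hNn : ‖N‖ ≤ specNorm S.B * ‖D‖ * ‖S.X K₂‖ := by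
    refine (norm_mul_le_specNorm_mul _ _).trans ?_
    rw [mul_assoc]
    exact mul_le_mul_of_nonneg_left (Matrix.frobenius_norm_mul _ _) (specNorm_nonneg _)
  calc ‖-(N + Nᵀ)‖ = ‖N + Nᵀ‖ := norm_neg _
    _ ≤ ‖N‖ + ‖Nᵀ‖ := norm_add_le _ _
    _ = 2 * ‖N‖ := by rw [Matrix.frobenius_norm_transpose]; ring
    _ ≤ _ := by gcongr

/-- The factor `(‖K₁‖ + ‖K₂‖) / 2`, rather than the sum of the norms, is what the constant `L_f`
requires. -/
lemma norm_P_sub_le (hS : S.IsPositive) (h₁ : K₁ ∈ S.stabilizing) (h₂ : K₂ ∈ S.stabilizing) :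
    ‖S.P K₁ - S.P K₂‖ ≤ 2 * (‖K₁ - K₂‖ * (specNorm S.B * ‖S.P K₂‖
      + specNorm S.R * ((‖K₁‖ + ‖K₂‖) / 2))) / lambdaMin S.Q * (S.P K₁).trace := by
  set D := K₁ - K₂ with hD
  -- The quadratic term `K₁ᵀ R K₁ - K₂ᵀ R K₂` is symmetrized around the midpoint of the gains.
  set N := Dᵀ * (S.R * ((1 / 2 : ℝ) • (K₁ + K₂)) - S.Bᵀ * S.P K₂) with hN
  have hP₂s := (hS.P_posSemidef h₂).isSymm
  have hZ : (S.closedLoop K₁)ᵀ * (S.P K₁ - S.P K₂) + (S.P K₁ - S.P K₂) * (S.closedLoop K₁)ᵀᵀ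
      + (N + Nᵀ) = 0 := by
    have e1 := hS.P_lyapunov h₁
    have e2 := hS.P_lyapunov h₂
    rw [← sub_self (0 : Matrix (Fin n) (Fin n) ℝ)]
    nth_rw 1 [← e1]
    rw [← e2]
    simp only [hN, hD, closedLoop, weight, Matrix.transpose_sub, Matrix.transpose_mul,
      Matrix.transpose_add, Matrix.transpose_smul, Matrix.transpose_transpose, Matrix.mul_sub,
      Matrix.sub_mul, Matrix.mul_add, Matrix.mul_smul, Matrix.mul_assoc, hP₂s, hS.R_transpose]
    module
  have h := norm_le_of_lyapunov (IsHurwitz.transpose h₁) hS.lambdaMin_Q_pos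
    (hS.weight_posSemidef K₁).isSymm (hS.weight_sub_posSemidef K₁)
    (by rw [Matrix.transpose_transpose]; exact hS.P_lyapunov h₁) (by simp [add_comm]) hZ
  refine h.trans ?_
  have hl := hS.lambdaMin_Q_pos
  have htr := (hS.P_posSemidef h₁).trace_nonneg
  have hB := specNorm_nonneg S.B
  have hR := specNorm_nonneg S.R
  gcongr
  have hmid : ‖(1 / 2 : ℝ) • (K₁ + K₂)‖ ≤ (‖K₁‖ + ‖K₂‖) / 2 := by
    rw [norm_smul, Real.norm_of_nonneg (by norm_num)]
    linarith [norm_add_le K₁ K₂]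
  have hNn : ‖N‖ ≤ ‖D‖ * (specNorm S.B * ‖S.P K₂‖
      + specNorm S.R * ((‖K₁‖ + ‖K₂‖) / 2)) := by
    refine (Matrix.frobenius_norm_mul _ _).trans ?_
    rw [Matrix.frobenius_norm_transpose]
    gcongr
    refine (norm_sub_le _ _).trans ?_
    rw [add_comm]
    refine add_le_add (norm_transpose_mul_le _ _) ((norm_mul_le_specNorm_mul _ _).trans ?_)
    gcongr
  calc ‖N + Nᵀ‖ ≤ ‖N‖ + ‖Nᵀ‖ := norm_add_le _ _
    _ = 2 * ‖N‖ := by rw [Matrix.frobenius_norm_transpose]; ring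
    _ ≤ _ := by gcongr

lemma norm_E_le (hS : S.IsPositive) (hK : K ∈ S.sublevel a) :
    ‖S.E K‖ ≤ a * (specNorm S.B / lambdaMin S.Ω
      + specNorm S.R / √(S.nu * lambdaMin S.R)) := by
  have hB := specNorm_nonneg S.B
  have hR := specNorm_nonneg S.R
  calc ‖S.E K‖ ≤ ‖S.R * K‖ + ‖S.Bᵀ * S.P K‖ := norm_sub_le _ _
    _ ≤ specNorm S.R * ‖K‖ + specNorm S.B * ‖S.P K‖ :=
        add_le_add (norm_mul_le_specNorm_mul _ _) (norm_transpose_mul_le _ _)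
    _ ≤ specNorm S.R * (a / √(S.nu * lambdaMin S.R)) + specNorm S.B * (a / lambdaMin S.Ω) := by
        gcongr
        · exact hS.norm_le_of_mem_sublevel hK
        · exact hS.norm_P_le hK
    _ = _ := by ring

/-- The map `K ↦ 2 E(K) X(K)` is Lipschitz with constant `L_f` on a sublevel set. The difference is
expanded exactly, so convexity of the sublevel set is not needed. -/
lemma norm_E_mul_X_sub_le (hS : S.IsPositive) (h₁ : K₁ ∈ S.sublevel a) (h₂ : K₂ ∈ S.sublevel a) :
    ‖(2 : ℝ) • (S.E K₁ * S.X K₁) - (2 : ℝ) • (S.E K₂ * S.X K₂)‖ ≤ S.LF a * ‖K₁ - K₂‖ := by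
  have ha := hS.level_pos h₁
  have hB := specNorm_nonneg S.B
  have hR := specNorm_nonneg S.R
  have hq := hS.lambdaMin_Q_pos
  have hr := hS.lambdaMin_R_pos
  have ho := hS.lambdaMin_Ω_pos
  have hν := hS.nu_pos ⟨K₁, h₁.1⟩
  set D := K₁ - K₂ with hD
  set e := specNorm S.B / lambdaMin S.Ω + specNorm S.R / √(S.nu * lambdaMin S.R) with he
  have he0 : 0 ≤ e := by positivity
  have hX := hS.norm_X_sub_le h₁.1 h₂.1
  have hP := hS.norm_P_sub_le h₁.1 h₂.1
  rw [← hD] at hX hP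
  have hX' : ‖S.X K₁ - S.X K₂‖ ≤ 2 * (specNorm S.B * ‖D‖ * (a / lambdaMin S.Q)) / lambdaMin S.Ω
      * (a / lambdaMin S.Q) := by
    refine hX.trans ?_
    gcongr
    · exact (hS.X_posSemidef h₁.1).trace_nonneg
    · exact hS.norm_X_le h₂
    · exact hS.trace_X_le h₁
  have hP' : ‖S.P K₁ - S.P K₂‖ ≤ 2 * (‖D‖ * (a * e)) / lambdaMin S.Q * (a / lambdaMin S.Ω) := by
    refine hP.trans ?_
    have h1 : specNorm S.B * ‖S.P K₂‖ + specNorm S.R * ((‖K₁‖ + ‖K₂‖) / 2) ≤ a * e := by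
      have e1 : (‖K₁‖ + ‖K₂‖) / 2 ≤ a / √(S.nu * lambdaMin S.R) := by
        linarith [hS.norm_le_of_mem_sublevel h₁, hS.norm_le_of_mem_sublevel h₂]
      calc specNorm S.B * ‖S.P K₂‖ + specNorm S.R * ((‖K₁‖ + ‖K₂‖) / 2)
          ≤ specNorm S.B * (a / lambdaMin S.Ω)
            + specNorm S.R * (a / √(S.nu * lambdaMin S.R)) := by
            gcongr
            exact hS.norm_P_le h₂
        _ = a * e := by rw [he]; ring
    gcongr
    · exact (hS.P_posSemidef h₁.1).trace_nonneg
    · exact hS.trace_P_le h₁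
  have hsplit : (2 : ℝ) • (S.E K₁ * S.X K₁) - (2 : ℝ) • (S.E K₂ * S.X K₂)
      = (2 : ℝ) • (S.R * (D * S.X K₁) - S.Bᵀ * ((S.P K₁ - S.P K₂) * S.X K₁)
        + S.E K₂ * (S.X K₁ - S.X K₂)) := by
    simp only [E, hD, Matrix.mul_sub, Matrix.sub_mul, Matrix.mul_assoc]
    module
  rw [hsplit, norm_smul, Real.norm_of_nonneg zero_le_two]
  have t1 : ‖S.R * (D * S.X K₁)‖ ≤ specNorm S.R * (‖D‖ * (a / lambdaMin S.Q)) := by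
    refine (norm_mul_le_specNorm_mul _ _).trans ?_
    gcongr
    refine (Matrix.frobenius_norm_mul _ _).trans ?_
    gcongr
    exact hS.norm_X_le h₁
  have t2 : ‖S.Bᵀ * ((S.P K₁ - S.P K₂) * S.X K₁)‖ ≤ specNorm S.B *
      (2 * (‖D‖ * (a * e)) / lambdaMin S.Q * (a / lambdaMin S.Ω) * (a / lambdaMin S.Q)) := by
    refine (norm_transpose_mul_le _ _).trans ?_
    gcongr
    refine (Matrix.frobenius_norm_mul _ _).trans ?_
    gcongr
    exact hS.norm_X_le h₁
  have t3 : ‖S.E K₂ * (S.X K₁ - S.X K₂)‖ ≤ a * e * (2 * (specNorm S.B * ‖D‖ * (a / lambdaMin S.Q))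
      / lambdaMin S.Ω * (a / lambdaMin S.Q)) := by
    refine (Matrix.frobenius_norm_mul _ _).trans ?_
    gcongr
    exact hS.norm_E_le h₂
  calc 2 * ‖S.R * (D * S.X K₁) - S.Bᵀ * ((S.P K₁ - S.P K₂) * S.X K₁)
        + S.E K₂ * (S.X K₁ - S.X K₂)‖
      ≤ 2 * (‖S.R * (D * S.X K₁)‖ + ‖S.Bᵀ * ((S.P K₁ - S.P K₂) * S.X K₁)‖
        + ‖S.E K₂ * (S.X K₁ - S.X K₂)‖) := by
        gcongr
        exact (norm_add_le _ _).trans (by gcongr; exact norm_sub_le _ _)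
    _ ≤ 2 * (specNorm S.R * (‖D‖ * (a / lambdaMin S.Q)) + specNorm S.B *
      (2 * (‖D‖ * (a * e)) / lambdaMin S.Q * (a / lambdaMin S.Ω) * (a / lambdaMin S.Q))
        + a * e * (2 * (specNorm S.B * ‖D‖ * (a / lambdaMin S.Q))
      / lambdaMin S.Ω * (a / lambdaMin S.Q))) := by gcongr
    _ = S.LF a * ‖D‖ := by
        rw [LF, ← he]
        field_simp
        ring

/-! ### Differentiability of the objective -/

/-- Near a stabilizing gain all gains are stabilizing, with a uniform bound for `X`: the matrix
`X(K)` remains a Lyapunov certificate, with right-hand side at least `Ω / 2`. -/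
lemma exists_radius (hS : S.IsPositive) (hK : K ∈ S.stabilizing) : ∃ δ > 0, ∀ K',
    ‖K' - K‖ ≤ δ → K' ∈ S.stabilizing ∧ (S.X K').trace ≤ 2 * (S.X K).trace := by
  have ho := hS.lambdaMin_Ω_pos
  have hb := specNorm_nonneg S.B
  refine ⟨lambdaMin S.Ω / (4 * (specNorm S.B * ‖S.X K‖ + 1)), by positivity, fun K' hK' => ?_⟩
  have hXs := (hS.X_posSemidef hK).isSymm
  set N := S.B * ((K' - K) * S.X K) with hN
  have hNn : ‖N + Nᵀ‖ ≤ lambdaMin S.Ω / 2 := by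
    have h1 : ‖N‖ ≤ specNorm S.B * (‖K' - K‖ * ‖S.X K‖) :=
      (norm_mul_le_specNorm_mul _ _).trans
        (mul_le_mul_of_nonneg_left (Matrix.frobenius_norm_mul _ _) hb)
    have h2 : ‖N + Nᵀ‖ ≤ 2 * ‖N‖ := by
      refine (norm_add_le _ _).trans_eq ?_
      rw [Matrix.frobenius_norm_transpose]; ring
    rw [le_div_iff₀ (by positivity)] at hK'
    nlinarith [norm_nonneg (K' - K)]
  have hlyap : S.closedLoop K' * S.X K + S.X K * (S.closedLoop K')ᵀ + (S.Ω + (N + Nᵀ)) = 0 := by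
    rw [← hS.X_lyapunov hK]
    simp only [hN, closedLoop, Matrix.transpose_sub, Matrix.transpose_mul, Matrix.mul_sub,
      Matrix.sub_mul, Matrix.mul_assoc, hXs]
    abel
  have hhalf : ((1 / 2 : ℝ) • S.Ω + (N + Nᵀ)).PosSemidef := by
    have h1 := hS.Ω_sub_posSemidef.smul (show (0 : ℝ) ≤ 1 / 2 by norm_num)
    have h2 := smul_one_add_posSemidef (C := N + Nᵀ) (by simp [add_comm]) hNn
    convert h1.add h2 using 1
    module
  have hstab : K' ∈ S.stabilizing := by
    refine isHurwitz_of_lyapunov (hS.X_posSemidef hK) ?_ hlyap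
    have := (hS.Ω_posDef.smul (show (0 : ℝ) < 1 / 2 by norm_num)).add_posSemidef hhalf
    convert this using 1
    module
  refine ⟨hstab, ?_⟩
  have hX' := hS.X_posSemidef hstab
  have hdiff : S.closedLoop K' * ((2 : ℝ) • S.X K - S.X K')
      + ((2 : ℝ) • S.X K - S.X K') * (S.closedLoop K')ᵀ
      + (2 : ℝ) • ((1 / 2 : ℝ) • S.Ω + (N + Nᵀ)) = 0 := by
    have h1 := hS.X_lyapunov hstab
    have : (2 : ℝ) • (S.closedLoop K' * S.X K + S.X K * (S.closedLoop K')ᵀ + (S.Ω + (N + Nᵀ)))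
      - (S.closedLoop K' * S.X K' + S.X K' * (S.closedLoop K')ᵀ + S.Ω) = 0 := by
      rw [hlyap, h1]; simp
    rw [← this]
    simp only [Matrix.mul_sub, Matrix.sub_mul, Matrix.mul_smul, Matrix.smul_mul]
    module
  have := (lyapunov_posSemidef hstab (by simp [hXs, hX'.isSymm])
    (hhalf.smul zero_le_two) hdiff).trace_nonneg
  rw [Matrix.trace_sub, Matrix.trace_smul, smul_eq_mul] at this
  linarith

lemma stabilizing_mem_nhds (hS : S.IsPositive) (hK : K ∈ S.stabilizing) :
    S.stabilizing ∈ nhds K := by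
  obtain ⟨δ, hδ, h⟩ := hS.exists_radius hK
  refine Filter.mem_of_superset (Metric.closedBall_mem_nhds K hδ) fun K' hK' => (h K' ?_).1
  rwa [← dist_eq_norm]

/-- The linear functional `J ↦ tr (Gᵀ J)` on matrices. -/
def frobeniusDual (G : Matrix (Fin m) (Fin n) ℝ) : Matrix (Fin m) (Fin n) ℝ →ₗ[ℝ] ℝ where
  toFun J := (Gᵀ * J).trace
  map_add' J J' := by rw [Matrix.mul_add, Matrix.trace_add]
  map_smul' c J := by simp

/-- The linear part of the exact expansion is the Frobenius product with `2 E(K) X(K)`. -/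
lemma linear_term (hS : S.IsPositive) (hK : K ∈ S.stabilizing) (D : Matrix (Fin m) (Fin n) ℝ) :
    ((Dᵀ * S.E K + (S.E K)ᵀ * D) * S.X K).trace = (((2 : ℝ) • (S.E K * S.X K))ᵀ * D).trace := by
  have hXs := (hS.X_posSemidef hK).isSymm
  have h1 : (Dᵀ * S.E K * S.X K).trace = ((S.E K)ᵀ * D * S.X K).trace := by
    rw [← Matrix.trace_transpose]
    simp only [Matrix.transpose_mul, Matrix.transpose_transpose, hXs]
    rw [Matrix.trace_mul_comm]
  rw [Matrix.add_mul, Matrix.trace_add, h1, Matrix.transpose_smul, Matrix.transpose_mul, hXs,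
    Matrix.smul_mul, Matrix.trace_smul, Matrix.mul_assoc (S.X K), Matrix.trace_mul_comm (S.X K),
    smul_eq_mul]
  ring

lemma hasFDerivAt_obj (hS : S.IsPositive) (hK : K ∈ S.stabilizing) :
    HasFDerivAt S.obj
      (LinearMap.toContinuousLinearMap (frobeniusDual ((2 : ℝ) • (S.E K * S.X K)))) K := by
  obtain ⟨δ, hδ, hnear⟩ := hS.exists_radius hK
  have hb := specNorm_nonneg S.B
  have hr := specNorm_nonneg S.R
  have ho := hS.lambdaMin_Ω_pos
  have ht := (hS.X_posSemidef hK).trace_nonneg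
  set M := specNorm S.R * (2 * (S.X K).trace) + 2 * ‖S.E K‖ *
    (2 * (specNorm S.B * ‖S.X K‖) / lambdaMin S.Ω * (2 * (S.X K).trace)) with hM
  refine HasFDerivAt.of_isLittleO ?_
  have hO : (fun K' => S.obj K' - S.obj K - (frobeniusDual ((2 : ℝ) • (S.E K * S.X K))) (K' - K))
      =O[nhds K] fun K' => ‖K' - K‖ ^ 2 := by
    refine Asymptotics.IsBigO.of_bound M ?_
    filter_upwards [Metric.closedBall_mem_nhds K hδ] with K' hK'
    rw [mem_closedBall_iff_norm] at hK'
    obtain ⟨hs, htr⟩ := hnear K' hK'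
    set D := K' - K with hD
    have hX'n : ‖S.X K'‖ ≤ 2 * (S.X K).trace := (norm_le_trace (hS.X_posSemidef hs)).trans htr
    have hXX := hS.norm_X_sub_le hs hK
    rw [← hD] at hXX
    have heq : S.obj K' - S.obj K - frobeniusDual ((2 : ℝ) • (S.E K * S.X K)) D
        = (Dᵀ * (S.R * D * S.X K')).trace
          + ((Dᵀ * S.E K + (S.E K)ᵀ * D) * (S.X K' - S.X K)).trace := by
      change _ - (((2 : ℝ) • (S.E K * S.X K))ᵀ * D).trace = _
      rw [hS.obj_sub_obj hs hK, ← hS.linear_term hK]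
      simp only [← hD, Matrix.add_mul, Matrix.mul_sub, Matrix.trace_add, Matrix.trace_sub,
        Matrix.mul_assoc]
      ring
    have b1 : |(Dᵀ * (S.R * D * S.X K')).trace|
        ≤ ‖D‖ * (specNorm S.R * ‖D‖ * (2 * (S.X K).trace)) := by
      refine (abs_trace_mul_le _ _).trans ?_
      rw [Matrix.frobenius_norm_transpose]
      gcongr
      refine (Matrix.frobenius_norm_mul _ _).trans ?_
      gcongr
      exact norm_mul_le_specNorm_mul _ _
    have b2 : |((Dᵀ * S.E K + (S.E K)ᵀ * D) * (S.X K' - S.X K)).trace| ≤ 2 * ‖D‖ * ‖S.E K‖ *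
        (2 * (specNorm S.B * ‖D‖ * ‖S.X K‖) / lambdaMin S.Ω * (2 * (S.X K).trace)) := by
      refine (abs_trace_mul_le _ _).trans ?_
      gcongr
      · refine (norm_add_le _ _).trans ?_
        have e1 := Matrix.frobenius_norm_mul Dᵀ (S.E K)
        have e2 := Matrix.frobenius_norm_mul (S.E K)ᵀ D
        rw [Matrix.frobenius_norm_transpose] at e1 e2
        linarith
      · refine hXX.trans ?_
        gcongr
    rw [heq, Real.norm_eq_abs, Real.norm_of_nonneg (by positivity)]
    refine (abs_add_le _ _).trans ((add_le_add b1 b2).trans_eq ?_)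
    rw [hM]; ring
  refine hO.trans_isLittleO ?_
  have h1 : (fun K' : Matrix (Fin m) (Fin n) ℝ => ‖K' - K‖ ^ 2) =o[nhds K] fun K' => K' - K := by
    have h0 : Filter.Tendsto (fun K' : Matrix (Fin m) (Fin n) ℝ => K' - K) (nhds K) (nhds 0) := by
      have : Continuous fun K' : Matrix (Fin m) (Fin n) ℝ => K' - K :=
        continuous_id.sub continuous_const
      simpa using this.tendsto K
    exact (Asymptotics.isLittleO_norm_pow_id one_lt_two).comp_tendsto h0
  exact h1

lemma grad_eq (hS : S.IsPositive) (hK : K ∈ S.stabilizing) :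
    S.grad K = (2 : ℝ) • (S.E K * S.X K) := by
  ext i j
  rw [grad, Matrix.of_apply, (hS.hasFDerivAt_obj hK).fderiv]
  change (((2 : ℝ) • (S.E K * S.X K))ᵀ * Matrix.single i j (1 : ℝ)).trace = _
  rw [Matrix.trace_mul_single]
  simp

lemma norm_grad_sub_le (hS : S.IsPositive) (h₁ : K₁ ∈ S.sublevel a) (h₂ : K₂ ∈ S.sublevel a) :
    ‖S.grad K₁ - S.grad K₂‖ ≤ S.LF a * ‖K₁ - K₂‖ := by
  rw [hS.grad_eq h₁.1, hS.grad_eq h₂.1]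
  exact hS.norm_E_mul_X_sub_le h₁ h₂

/-! ### Compactness of the sublevel sets and the minimizer -/

/-- A sublevel set is the projection of a compact set of pairs `(K, X)`, where `X` is a positive
semidefinite certificate of the Lyapunov equation. -/
lemma isCompact_sublevel (hS : S.IsPositive) (a : ℝ) : IsCompact (S.sublevel a) := by
  let T : Set (Matrix (Fin m) (Fin n) ℝ × Matrix (Fin n) (Fin n) ℝ) :=
    (Metric.closedBall 0 (a / √(S.nu * lambdaMin S.R)) ×ˢ
        Metric.closedBall 0 (a / lambdaMin S.Q)) ∩
      ({p | p.2ᵀ = p.2} ∩ {p | ∀ v : Fin n → ℝ, 0 ≤ v ⬝ᵥ (p.2 *ᵥ v)} ∩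
      {p | S.closedLoop p.1 * p.2 + p.2 * (S.closedLoop p.1)ᵀ + S.Ω = 0} ∩
      {p | (S.weight p.1 * p.2).trace ≤ a})
  have hT : IsCompact T := by
    have hc1 : Continuous fun p : Matrix (Fin m) (Fin n) ℝ × Matrix (Fin n) (Fin n) ℝ =>
        S.closedLoop p.1 := continuous_const.sub (continuous_const.matrix_mul continuous_fst)
    have hc2 : Continuous fun p : Matrix (Fin m) (Fin n) ℝ × Matrix (Fin n) (Fin n) ℝ =>
        S.weight p.1 := continuous_const.add
          ((continuous_fst.matrix_transpose.matrix_mul continuous_const).matrix_mul continuous_fst)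
    refine ((isCompact_closedBall _ _).prod (isCompact_closedBall _ _)).inter_right
      (((IsClosed.inter ?_ ?_).inter ?_).inter ?_)
    · exact isClosed_eq continuous_snd.matrix_transpose continuous_snd
    · rw [Set.ofPred_forall]
      exact isClosed_iInter fun v => isClosed_le continuous_const
        (continuous_const.dotProduct (continuous_snd.matrix_mulVec continuous_const))
    · exact isClosed_eq (((hc1.matrix_mul continuous_snd).add
        (continuous_snd.matrix_mul hc1.matrix_transpose)).add continuous_const) continuous_const
    · exact isClosed_le (hc2.matrix_mul continuous_snd).matrix_trace continuous_const
  have hEq : S.sublevel a = Prod.fst '' T := by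
    ext K
    constructor
    · intro hK
      have hX := hS.X_posSemidef hK.1
      refine ⟨(K, S.X K), ⟨⟨?_, ?_⟩, ⟨⟨hX.isSymm, fun v => ?_⟩, hS.X_lyapunov hK.1⟩, hK.2⟩, rfl⟩
      · exact mem_closedBall_zero_iff.2 (hS.norm_le_of_mem_sublevel hK)
      · exact mem_closedBall_zero_iff.2 (hS.norm_X_le hK)
      · simpa using hX.dotProduct_mulVec_nonneg v
    · rintro ⟨⟨K, X⟩, ⟨-, ⟨⟨hs, hpos⟩, hl⟩, ha⟩, rfl⟩
      have hK : K ∈ S.stabilizing :=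
        isHurwitz_of_lyapunov (posSemidef_of_forall hs hpos) hS.Ω_posDef hl
      refine ⟨hK, ?_⟩
      have hXe : S.X K = X := hS.X_eq hK hl
      change (S.weight K * S.X K).trace ≤ a
      rw [hXe]
      exact ha
  rw [hEq]
  exact hT.image continuous_fst

lemma exists_minimizer (hS : S.IsPositive) (hne : S.stabilizing.Nonempty) :
    ∃ Kopt ∈ S.stabilizing, ∀ K ∈ S.stabilizing, S.obj Kopt ≤ S.obj K := by
  obtain ⟨K₀, hK₀⟩ := hne
  have hcont : ContinuousOn S.obj (S.sublevel (S.obj K₀)) := fun K hK =>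
    (hS.hasFDerivAt_obj hK.1).continuousAt.continuousWithinAt
  obtain ⟨Kopt, hKopt, hmin⟩ := (hS.isCompact_sublevel (S.obj K₀)).exists_isMinOn
    ⟨K₀, hK₀, le_rfl⟩ hcont
  refine ⟨Kopt, hKopt.1, fun K hK => ?_⟩
  rcases le_total (S.obj K) (S.obj K₀) with h | h
  · exact hmin ⟨hK, h⟩
  · exact hKopt.2.trans h

/-- The gradient of the objective vanishes at a minimizer, hence so does `E`. -/
lemma E_eq_zero (hS : S.IsPositive) {Kopt : Matrix (Fin m) (Fin n) ℝ}
    (hKopt : Kopt ∈ S.stabilizing) (hmin : ∀ K ∈ S.stabilizing, S.obj Kopt ≤ S.obj K) :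
    S.E Kopt = 0 := by
  have hloc : IsLocalMin S.obj Kopt := by
    filter_upwards [hS.stabilizing_mem_nhds hKopt] with K hK using hmin K hK
  have hg : (2 : ℝ) • (S.E Kopt * S.X Kopt) = 0 := by
    rw [← hS.grad_eq hKopt]
    ext i j
    exact DFunLike.congr_fun hloc.fderiv_eq_zero (Matrix.single i j 1)
  have hEX : S.E Kopt * S.X Kopt = 0 := (smul_eq_zero.1 hg).resolve_left two_ne_zero
  have hK : Kopt ∈ S.sublevel (S.obj Kopt) := ⟨hKopt, le_rfl⟩
  have h1 := mul_trace_le_trace_mul (hS.X_sub_posSemidef hK)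
    (posSemidef_transpose_mul_self (S.E Kopt))
  rw [trace_transpose_mul_self, Matrix.trace_mul_comm, Matrix.mul_assoc, hEX, Matrix.mul_zero,
    Matrix.trace_zero] at h1
  have h2 : 0 < S.nu / S.obj Kopt := div_pos (hS.nu_pos ⟨Kopt, hKopt⟩) (hS.obj_pos hKopt)
  have h3 : ‖S.E Kopt‖ ^ 2 ≤ 0 := by nlinarith
  simpa using le_antisymm h3 (sq_nonneg _)

/-! ### Quadratic growth and the Polyak–Łojasiewicz inequality -/

lemma obj_sub_obj_of_E_eq_zero (hS : S.IsPositive) (hK : K ∈ S.stabilizing)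
    (hKopt : Kopt ∈ S.stabilizing) (hE : S.E Kopt = 0) :
    S.obj K - S.obj Kopt = (((K - Kopt)ᵀ * S.R * (K - Kopt)) * S.X K).trace := by
  rw [hS.obj_sub_obj hK hKopt, hE]
  simp

lemma quadratic_growth (hS : S.IsPositive) (hK : K ∈ S.sublevel a) (hKopt : Kopt ∈ S.stabilizing)
    (hE : S.E Kopt = 0) :
    S.nu / a * (lambdaMin S.R * ‖K - Kopt‖ ^ 2) ≤ S.obj K - S.obj Kopt := by
  have ha := hS.level_pos hK
  have hν := hS.nu_pos ⟨K, hK.1⟩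
  rw [hS.obj_sub_obj_of_E_eq_zero hK.1 hKopt hE, Matrix.trace_mul_comm]
  exact (mul_le_mul_of_nonneg_left (hS.mul_norm_sq_le_trace_control _) (by positivity)).trans
    (mul_trace_le_trace_mul (hS.X_sub_posSemidef hK) (hS.control_posSemidef _))

lemma quadratic_upper (hS : S.IsPositive) (hK : K ∈ S.sublevel a) (hKopt : Kopt ∈ S.stabilizing)
    (hE : S.E Kopt = 0) :
    S.obj K - S.obj Kopt ≤ specNorm S.R * (a / lambdaMin S.Q) * ‖K - Kopt‖ ^ 2 := by
  have hR := specNorm_nonneg S.R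
  rw [hS.obj_sub_obj_of_E_eq_zero hK.1 hKopt hE, Matrix.mul_assoc]
  set D := K - Kopt
  calc (Dᵀ * S.R * (D * S.X K)).trace ≤ ‖Dᵀ * S.R‖ * ‖D * S.X K‖ := trace_mul_le _ _
    _ ≤ (‖D‖ * specNorm S.R) * (‖D‖ * (a / lambdaMin S.Q)) := by
        gcongr
        · have := norm_mul_le_mul_specNorm Dᵀ S.R
          rwa [Matrix.frobenius_norm_transpose] at this
        · refine (Matrix.frobenius_norm_mul _ _).trans ?_
          gcongr
          exact hS.norm_X_le hK
    _ = _ := by ring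

/-- No gain of the sublevel set improves on `K` by more than a multiple of `‖E(K)‖²`: complete the
square in the exact expansion of the objective around `K`. -/
lemma obj_sub_le_norm_E_sq (hS : S.IsPositive) (h₁ : K₁ ∈ S.sublevel a) (hK : K ∈ S.stabilizing) :
    S.obj K - S.obj K₁ ≤ (lambdaMin S.R)⁻¹ * (‖S.E K‖ ^ 2 * (a / lambdaMin S.Q)) := by
  have hr := hS.lambdaMin_R_pos
  have hexp := hS.obj_sub_obj h₁.1 hK
  set D := K₁ - K with hD
  set l := lambdaMin S.R with hl
  have hsq : (Dᵀ * S.R * D + Dᵀ * S.E K + (S.E K)ᵀ * D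
      + l⁻¹ • ((S.E K)ᵀ * S.E K)).PosSemidef := by
    have h1 := (lambdaMin_spec hS.m_pos hS.R_transpose).1.congr_transpose Dᵀ
    have h2 := (posSemidef_transpose_mul_self (D + l⁻¹ • S.E K)).smul hr.le
    rw [Matrix.transpose_transpose, ← hl] at h1
    convert h1.add h2 using 1
    simp only [Matrix.transpose_add, Matrix.transpose_smul, Matrix.mul_add, Matrix.add_mul,
      Matrix.mul_sub, Matrix.sub_mul, Matrix.mul_smul, Matrix.smul_mul, Matrix.mul_one, smul_add,
      smul_smul]
    have hll : l * l⁻¹ = 1 := mul_inv_cancel₀ hr.ne'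
    have hlll : l * (l⁻¹ * l⁻¹) = l⁻¹ := by rw [← mul_assoc, hll, one_mul]
    rw [hll, hlll, one_smul, one_smul]
    abel
  have hnn := trace_mul_nonneg hsq (hS.X_posSemidef h₁.1)
  rw [Matrix.add_mul, Matrix.trace_add, ← hexp, Matrix.smul_mul, Matrix.trace_smul,
    smul_eq_mul] at hnn
  have hb : ((S.E K)ᵀ * S.E K * S.X K₁).trace ≤ ‖S.E K‖ ^ 2 * (a / lambdaMin S.Q) := by
    rw [Matrix.mul_assoc]
    calc ((S.E K)ᵀ * (S.E K * S.X K₁)).trace ≤ ‖(S.E K)ᵀ‖ * ‖S.E K * S.X K₁‖ := trace_mul_le _ _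
      _ ≤ ‖S.E K‖ * (‖S.E K‖ * (a / lambdaMin S.Q)) := by
          rw [Matrix.frobenius_norm_transpose]
          gcongr
          refine (Matrix.frobenius_norm_mul _ _).trans ?_
          gcongr
          exact hS.norm_X_le h₁
      _ = _ := by ring
  have := mul_le_mul_of_nonneg_left hb (inv_pos.2 hr).le
  linarith

/-- `E(K)` is controlled by the gradient, as `X(K) ≥ ν / a`. -/
lemma norm_E_le_norm_grad (hS : S.IsPositive) (hK : K ∈ S.sublevel a) :
    2 * (S.nu / a) * ‖S.E K‖ ≤ ‖S.grad K‖ := by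
  rw [hS.grad_eq hK.1, norm_smul, Real.norm_of_nonneg zero_le_two, mul_assoc]
  refine mul_le_mul_of_nonneg_left ?_ zero_le_two
  have h1 := mul_trace_le_trace_mul (hS.X_sub_posSemidef hK)
    (posSemidef_transpose_mul_self (S.E K))
  rw [trace_transpose_mul_self, Matrix.trace_mul_comm, Matrix.mul_assoc] at h1
  have h2 := trace_mul_le (S.E K)ᵀ (S.E K * S.X K)
  rw [Matrix.frobenius_norm_transpose] at h2
  rcases (norm_nonneg (S.E K)).eq_or_lt with h0 | h0
  · rw [← h0, mul_zero]; exact norm_nonneg _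
  · nlinarith

lemma isPL_plConst (hS : S.IsPositive) (hKopt : Kopt ∈ S.stabilizing)
    (hmin : ∀ K ∈ S.stabilizing, S.obj Kopt ≤ S.obj K) : S.IsPL Kopt a (S.plConst a) := by
  intro K hK
  have ha := hS.level_pos hK
  have hν := hS.nu_pos ⟨K, hK.1⟩
  have hr := hS.lambdaMin_R_pos
  have hq := hS.lambdaMin_Q_pos
  have h1 := hS.obj_sub_le_norm_E_sq ⟨hKopt, (hmin K hK.1).trans hK.2⟩ hK.1
  have h2 := pow_le_pow_left₀ (by positivity) (hS.norm_E_le_norm_grad hK) 2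
  calc 2 * S.plConst a * (S.obj K - S.obj Kopt)
      ≤ 2 * S.plConst a * ((lambdaMin S.R)⁻¹ * (‖S.E K‖ ^ 2 * (a / lambdaMin S.Q))) :=
        mul_le_mul_of_nonneg_left h1 (by rw [plConst]; positivity)
    _ = (2 * (S.nu / a) * ‖S.E K‖) ^ 2 := by rw [plConst]; field_simp
    _ ≤ _ := h2

lemma isPL_of_le {μ ν : ℝ} (hmin : ∀ K ∈ S.stabilizing, S.obj Kopt ≤ S.obj K) (hμν : μ ≤ ν)
    (h : S.IsPL Kopt a ν) : S.IsPL Kopt a μ := by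
  intro K hK
  refine le_trans ?_ (h K hK)
  have := sub_nonneg.2 (hmin K hK.1)
  gcongr

lemma plConst_pos (hS : S.IsPositive) (hK : K ∈ S.sublevel a) : 0 < S.plConst a := by
  have ha := hS.level_pos hK
  have hν := hS.nu_pos ⟨K, hK.1⟩
  have hr := hS.lambdaMin_R_pos
  have hq := hS.lambdaMin_Q_pos
  rw [plConst]; positivity

lemma lambdaMin_R_le (hS : S.IsPositive) : lambdaMin S.R ≤ specNorm S.R := by
  obtain ⟨-, V, hV, hRV⟩ := lambdaMin_spec hS.m_pos hS.R_transpose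
  have h := norm_mul_le_specNorm_mul S.R V
  rw [hRV, norm_smul, hV, mul_one, mul_one, Real.norm_of_nonneg hS.lambdaMin_R_pos.le] at h
  exact h

lemma two_mul_div_le_LF (hS : S.IsPositive) (hK : K ∈ S.sublevel a) :
    2 * a * specNorm S.R / lambdaMin S.Q ≤ S.LF a := by
  have ha := hS.level_pos hK
  have hq := hS.lambdaMin_Q_pos
  have ho := hS.lambdaMin_Ω_pos
  have hB := specNorm_nonneg S.B
  have hR := specNorm_nonneg S.R
  rw [LF]
  exact le_add_of_nonneg_right (by positivity)

lemma LF_pos (hS : S.IsPositive) (hK : K ∈ S.sublevel a) : 0 < S.LF a := by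
  have ha := hS.level_pos hK
  have hq := hS.lambdaMin_Q_pos
  have hR := hS.lambdaMin_R_pos.trans_le hS.lambdaMin_R_le
  exact lt_of_lt_of_le (by positivity) (hS.two_mul_div_le_LF hK)

lemma plConst_le_LF (hS : S.IsPositive) (hK : K ∈ S.sublevel a) : S.plConst a ≤ S.LF a := by
  have ha := hS.level_pos hK
  have hq := hS.lambdaMin_Q_pos
  have hr := hS.lambdaMin_R_pos
  have hν := hS.nu_pos ⟨K, hK.1⟩
  refine le_trans ?_ (hS.two_mul_div_le_LF hK)
  rw [plConst, div_le_div_iff₀ (by positivity) hq]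
  have h2 : (S.nu * lambdaMin S.Q) ^ 2 ≤ (a ^ 2) ^ 2 :=
    pow_le_pow_left₀ (by positivity) (hS.nu_le hK) 2
  calc 2 * lambdaMin S.R * lambdaMin S.Q * S.nu ^ 2 * lambdaMin S.Q
      = 2 * (lambdaMin S.R * (S.nu * lambdaMin S.Q) ^ 2) := by ring
    _ ≤ 2 * (specNorm S.R * (a ^ 2) ^ 2) := by
        gcongr
        · exact specNorm_nonneg _
        · exact hS.lambdaMin_R_le
    _ = _ := by ring

lemma muF_pos (hS : S.IsPositive) (hK : K ∈ S.sublevel a) : 0 < S.muF a := by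
  have ha := hS.level_pos hK
  have hq := hS.lambdaMin_Q_pos
  have hr := hS.lambdaMin_R_pos
  have ho := hS.lambdaMin_Ω_pos
  have hν := hS.nu_pos ⟨K, hK.1⟩
  have hB := specNorm_nonneg S.B
  have hη : 0 ≤ S.eta := div_nonneg (norm_nonneg _) (by positivity)
  have hL : 0 ≤ opNorm (Ring.inverse S.lyap) := norm_nonneg _
  rw [muF, mu, c]
  positivity

/-- `μ c²` does not exceed the constant `2 λ_min(R) λ_min(Q) ν² / a³`, because
`μ ≤ 2 λ_min(R) λ_min(Q) / a` and `c ≤ ν / a`. -/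
lemma muF_le_plConst (hS : S.IsPositive) (hK : K ∈ S.sublevel a) : S.muF a ≤ S.plConst a := by
  have ha := hS.level_pos hK
  have hq := hS.lambdaMin_Q_pos
  have hr := hS.lambdaMin_R_pos
  have ho := hS.lambdaMin_Ω_pos
  have hν := hS.nu_pos ⟨K, hK.1⟩
  have hB := specNorm_nonneg S.B
  have hη : 0 ≤ S.eta := div_nonneg (norm_nonneg _) (by positivity)
  have hL : 0 ≤ opNorm (Ring.inverse S.lyap) := norm_nonneg _
  have hmu : S.mu a ≤ 2 * lambdaMin S.R * lambdaMin S.Q / a := by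
    rw [mu]
    gcongr
    have : 1 ≤ (1 + a ^ 2 * S.eta) ^ 2 := one_le_pow₀ (by nlinarith [mul_nonneg (sq_nonneg a) hη])
    nlinarith
  have hs : 0 < √(S.nu * lambdaMin S.R) := by positivity
  have hc0 : 0 ≤ S.c a := by rw [c]; positivity
  have hc : S.c a ≤ S.nu / a := by
    rw [c, div_le_div_iff₀ (by positivity) ha]
    have : 0 ≤ S.nu * (2 * a ^ 2 * opNorm (Ring.inverse S.lyap) * specNorm S.B) := by positivity
    nlinarith
  calc S.muF a ≤ 2 * lambdaMin S.R * lambdaMin S.Q / a * (S.nu / a) ^ 2 := by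
        rw [muF]; gcongr
    _ = S.plConst a := by rw [plConst]; field_simp

/-! ### Gradient descent -/

lemma hasDerivAt_obj_line (hS : S.IsPositive) {G : Matrix (Fin m) (Fin n) ℝ} {s : ℝ}
    (hs : K - s • G ∈ S.stabilizing) :
    HasDerivAt (fun s : ℝ => S.obj (K - s • G)) (-((S.grad (K - s • G))ᵀ * G).trace) s := by
  have h1 : HasDerivAt (fun s : ℝ => K - s • G) (-((1 : ℝ) • G)) s :=
    ((hasDerivAt_id s).smul_const G).const_sub K
  refine ((hS.hasFDerivAt_obj hs).comp_hasDerivAt s h1).congr_deriv ?_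
  change (((2 : ℝ) • (S.E (K - s • G) * S.X (K - s • G)))ᵀ * -((1 : ℝ) • G)).trace = _
  rw [hS.grad_eq hs, one_smul, Matrix.mul_neg, Matrix.trace_neg]

/-- The sufficient decrease of a gradient step along which the iterate stays in the sublevel
set. -/
lemma obj_le_of_segment (hS : S.IsPositive) (hK : K ∈ S.sublevel a) {t : ℝ} (ht : 0 ≤ t)
    (hseg : ∀ s ∈ Set.Icc 0 t, K - s • S.grad K ∈ S.sublevel a) :
    S.obj (K - t • S.grad K) ≤ S.obj K - t * (1 - S.LF a * t / 2) * ‖S.grad K‖ ^ 2 := by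
  set G := S.grad K with hG
  have hd : ∀ s ∈ Set.Icc 0 t, HasDerivAt
      (fun s : ℝ => S.obj (K - s • G) + (s - S.LF a * s ^ 2 / 2) * ‖G‖ ^ 2)
      (-((S.grad (K - s • G))ᵀ * G).trace + (1 - S.LF a * s) * ‖G‖ ^ 2) s := by
    intro s hs
    refine (hS.hasDerivAt_obj_line (hseg s hs).1).add (HasDerivAt.mul_const ?_ _)
    refine (((hasDerivAt_id s).sub
      ((((hasDerivAt_id s).pow 2).const_mul (S.LF a)).div_const 2))).congr_deriv ?_
    simp
    ring
  have hanti := antitoneOn_of_deriv_nonpos (convex_Icc 0 t)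
    (fun s hs => (hd s hs).continuousAt.continuousWithinAt)
    (fun s hs => (hd s (interior_subset hs)).differentiableAt.differentiableWithinAt)
    (fun s hs => by
      have hs' := interior_subset hs
      rw [(hd s hs').deriv]
      have h1 : ‖S.grad K - S.grad (K - s • G)‖ ≤ S.LF a * (s * ‖G‖) := by
        have := hS.norm_grad_sub_le hK (hseg s hs')
        rwa [sub_sub_cancel, norm_smul, Real.norm_of_nonneg hs'.1] at this
      have h2 := trace_mul_le (S.grad K - S.grad (K - s • G))ᵀ G
      rw [Matrix.frobenius_norm_transpose, Matrix.transpose_sub, Matrix.sub_mul,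
        Matrix.trace_sub, ← hG, trace_transpose_mul_self] at h2
      have h3 := mul_le_mul_of_nonneg_right h1 (norm_nonneg G)
      rw [← hG] at h3
      nlinarith)
  have := hanti ⟨le_rfl, ht⟩ ⟨ht, le_rfl⟩ ht
  simp only [zero_smul, sub_zero] at this
  nlinarith

/-- A gradient step of length at most `2 / L_f` does not leave the sublevel set: at the first exit
time `t < 2 / L_f` the objective would already have dropped strictly below the level. -/
lemma segment_subset (hS : S.IsPositive) (hK : K ∈ S.sublevel a) {t : ℝ} (ht : t ≤ 2 / S.LF a) :
    ∀ s ∈ Set.Icc 0 t, K - s • S.grad K ∈ S.sublevel a := by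
  have hL := hS.LF_pos hK
  set G := S.grad K with hG
  rcases eq_or_ne G 0 with h0 | h0
  · intro s _; simpa [h0] using hK
  have hGpos : 0 < ‖G‖ ^ 2 := by have := norm_pos_iff.2 h0; positivity
  have hline : Continuous fun s : ℝ => K - s • G :=
    continuous_const.sub (continuous_id.smul continuous_const)
  have hclosed : IsClosed {s : ℝ | K - s • G ∈ S.sublevel a} :=
    (hS.isCompact_sublevel a).isClosed.preimage hline
  by_contra! hbad
  set bad : Set ℝ := {s | s ∈ Set.Icc 0 t ∧ K - s • G ∉ S.sublevel a} with hbaddef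
  have hne : bad.Nonempty := hbad
  have hbdd : BddBelow bad := ⟨0, fun s hs => hs.1.1⟩
  set u := sInf bad with hu
  have hu0 : 0 ≤ u := le_csInf hne fun s hs => hs.1.1
  have hut : u ≤ t := by
    obtain ⟨s, hs⟩ := hne
    exact (csInf_le hbdd hs).trans hs.1.2
  have hico : Set.Ico 0 u ⊆ {s : ℝ | K - s • G ∈ S.sublevel a} := by
    intro s hs
    by_contra hns
    exact notMem_of_lt_csInf hs.2 hbdd ⟨⟨hs.1, hs.2.le.trans hut⟩, hns⟩
  have hicc : Set.Icc 0 u ⊆ {s : ℝ | K - s • G ∈ S.sublevel a} := by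
    rcases hu0.eq_or_lt with h | h
    · rw [← h, Set.Icc_self, Set.singleton_subset_iff]
      simpa using hK
    · rw [← closure_Ico h.ne]
      exact hclosed.closure_subset_iff.2 hico
  have huS : K - u • G ∈ S.sublevel a := hicc ⟨hu0, le_rfl⟩
  have hut' : u < t := by
    obtain ⟨s, hs⟩ := hne
    refine lt_of_le_of_ne hut fun h => ?_
    have h1 : u ≤ s := csInf_le hbdd hs
    have h2 : s = u := le_antisymm (hs.1.2.trans h.ge) h1
    exact hs.2 (h2 ▸ huS)
  have hcont : ContinuousAt (fun s : ℝ => S.obj (K - s • G)) u :=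
    (hS.hasDerivAt_obj_line huS.1).continuousAt
  have hstab : ∀ᶠ s in nhdsWithin u (Set.Ioi u), K - s • G ∈ S.stabilizing :=
    nhdsWithin_le_nhds (hline.continuousAt.eventually_mem (hS.stabilizing_mem_nhds huS.1))
  have hobj : ∀ᶠ s in nhdsWithin u (Set.Ioi u), S.obj (K - s • G) ≤ a := by
    rcases hu0.eq_or_lt with h | h
    · -- At `u = 0` the objective may equal the level, but its derivative `-‖G‖²` is negative.
      rw [← h]
      have hder := hS.hasDerivAt_obj_line (K := K) (G := G) (s := 0) (by simpa using hK.1)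
      rw [zero_smul, sub_zero, ← hG, trace_transpose_mul_self] at hder
      have hslope := (hasDerivAt_iff_tendsto_slope.1 hder).eventually_lt_const (neg_lt_zero.2 hGpos)
      have hle : nhdsWithin (0 : ℝ) (Set.Ioi 0) ≤ nhdsWithin 0 {0}ᶜ :=
        nhdsWithin_mono _ fun s hs => (Set.mem_Ioi.1 hs).ne'
      filter_upwards [hle hslope, self_mem_nhdsWithin] with s hs hs0
      rw [Set.mem_Ioi] at hs0
      rw [slope_def_field, sub_zero, div_lt_iff₀ hs0, zero_mul, zero_smul, sub_zero] at hs
      linarith [hK.2]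
    · have hdec := hS.obj_le_of_segment hK hu0 hicc
      rw [← hG] at hdec
      have hlt : S.LF a * u < 2 := by
        have := hut'.trans_le ht
        rwa [lt_div_iff₀ hL, mul_comm] at this
      have hlt' : S.obj (K - u • G) < a := by
        have : 0 < u * (1 - S.LF a * u / 2) * ‖G‖ ^ 2 :=
          mul_pos (mul_pos h (by linarith)) hGpos
        linarith [hK.2]
      filter_upwards [nhdsWithin_le_nhds (hcont.eventually_lt_const hlt')] with s hs using hs.le
  obtain ⟨w, hw, hsub⟩ := (mem_nhdsGT_iff_exists_Ioo_subset' hut').1 (hstab.and hobj)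
  obtain ⟨s, hs, hsw⟩ := exists_lt_of_csInf_lt hne hw
  have hus : u < s := lt_of_le_of_ne (csInf_le hbdd hs) fun h => hs.2 (h ▸ huS)
  exact hs.2 (hsub ⟨hus, hsw⟩)

lemma step_mem (hS : S.IsPositive) (hK : K ∈ S.sublevel a) {α : ℝ} (hα : 0 < α)
    (hαL : α ≤ 2 / S.LF a) : K - α • S.grad K ∈ S.sublevel a :=
  hS.segment_subset hK hαL α ⟨hα.le, le_rfl⟩

lemma gd_mem (hS : S.IsPositive) (hK : K ∈ S.sublevel a) {α : ℝ} (hα : 0 < α)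
    (hαL : α ≤ 2 / S.LF a) (k : ℕ) : S.gd α K k ∈ S.sublevel a := by
  induction k with
  | zero => exact hK
  | succ k ih => exact hS.step_mem ih hα hαL

/-- One gradient step contracts the optimality gap by the factor `1 - α μ`. -/
lemma step_gap (hS : S.IsPositive) (hK : K ∈ S.sublevel a) {α μ : ℝ} (hα : 0 < α)
    (hαL : α ≤ 1 / S.LF a) (hPL : S.IsPL Kopt a μ) :
    S.obj (K - α • S.grad K) - S.obj Kopt ≤ (1 - α * μ) * (S.obj K - S.obj Kopt) := by
  have hL := hS.LF_pos hK
  have hαL2 : α ≤ 2 / S.LF a := hαL.trans (by gcongr; norm_num)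
  have hdec := hS.obj_le_of_segment hK hα.le (hS.segment_subset hK hαL2)
  rw [le_div_iff₀ hL] at hαL
  have h1 := mul_le_mul_of_nonneg_left (hPL K hK) hα.le
  have h2 : α / 2 * ‖S.grad K‖ ^ 2 ≤ α * (1 - S.LF a * α / 2) * ‖S.grad K‖ ^ 2 := by
    gcongr
    nlinarith
  linarith

/-- Linear convergence of gradient descent. The distance to the minimizer is compared with the
optimality gap through the quadratic bounds from below at step `k` and from above at step `0`. -/
lemma gd_gap (hS : S.IsPositive) (hKopt : Kopt ∈ S.stabilizing)
    (hmin : ∀ K ∈ S.stabilizing, S.obj Kopt ≤ S.obj K) (hK : K ∈ S.sublevel a) {α μ : ℝ}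
    (hα : 0 < α) (hαL : α ≤ 1 / S.LF a) (hPL : S.IsPL Kopt a μ) (k : ℕ) :
    S.obj (S.gd α K k) - S.obj Kopt ≤ (1 - α * μ) ^ k * (S.obj K - S.obj Kopt) ∧
      ‖S.gd α K k - Kopt‖ ^ 2 ≤ S.b a * (1 - α * μ) ^ k * ‖K - Kopt‖ ^ 2 := by
  have hL := hS.LF_pos hK
  have ha := hS.level_pos hK
  have hν := hS.nu_pos ⟨K, hK.1⟩
  have hr := hS.lambdaMin_R_pos
  have hq := hS.lambdaMin_Q_pos
  have hE := hS.E_eq_zero hKopt hmin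
  have hmem := hS.gd_mem hK hα (hαL.trans (by gcongr; norm_num))
  have hstep : ∀ j, S.obj (S.gd α K (j + 1)) - S.obj Kopt
      ≤ (1 - α * μ) * (S.obj (S.gd α K j) - S.obj Kopt) := fun j =>
    hS.step_gap (hmem j) hα hαL hPL
  have hgap : ∀ j, 0 ≤ S.obj (S.gd α K j) - S.obj Kopt := fun j =>
    sub_nonneg.2 (hmin _ (hmem j).1)
  have hlow : ∀ j, ‖S.gd α K j - Kopt‖ ^ 2 * (S.nu * lambdaMin S.R)
      ≤ a * (S.obj (S.gd α K j) - S.obj Kopt) := by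
    intro j
    have h := hS.quadratic_growth (hmem j) hKopt hE
    rw [div_mul_eq_mul_div, div_le_iff₀ ha] at h
    linarith
  rcases (hgap 0).eq_or_lt with h0 | h0
  · -- The initial gain is optimal, and the sign of `1 - α μ` is unknown.
    have hzero : ∀ j, S.obj (S.gd α K j) - S.obj Kopt = 0 := by
      intro j
      induction j with
      | zero => exact h0.symm
      | succ j ih =>
        have := hstep j
        rw [ih, mul_zero] at this
        exact le_antisymm this (hgap _)
    have hK0 : S.obj K - S.obj Kopt = 0 := h0.symm
    refine ⟨by rw [hzero, hK0, mul_zero], ?_⟩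
    have hlow0 : ∀ j, ‖S.gd α K j - Kopt‖ ^ 2 ≤ 0 := fun j =>
      nonpos_of_mul_nonpos_left ((hlow j).trans_eq (by rw [hzero, mul_zero])) (by positivity)
    have h2 : ‖K - Kopt‖ ^ 2 ≤ 0 := hlow0 0
    rw [le_antisymm h2 (sq_nonneg _), mul_zero]
    exact hlow0 k
  · have hγ : 0 ≤ 1 - α * μ := nonneg_of_mul_nonneg_left ((hgap 1).trans (hstep 0)) h0
    have hrate : S.obj (S.gd α K k) - S.obj Kopt
        ≤ (1 - α * μ) ^ k * (S.obj K - S.obj Kopt) := by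
      induction k with
      | zero => rw [pow_zero, one_mul]; rfl
      | succ k ih =>
        calc _ ≤ (1 - α * μ) * (S.obj (S.gd α K k) - S.obj Kopt) := hstep k
          _ ≤ (1 - α * μ) * ((1 - α * μ) ^ k * (S.obj K - S.obj Kopt)) := by gcongr
          _ = _ := by ring
    refine ⟨hrate, ?_⟩
    have hup := hS.quadratic_upper hK hKopt hE
    refine le_of_mul_le_mul_right ?_ (mul_pos hν hr)
    calc ‖S.gd α K k - Kopt‖ ^ 2 * (S.nu * lambdaMin S.R)
        ≤ a * (S.obj (S.gd α K k) - S.obj Kopt) := hlow k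
      _ ≤ a * ((1 - α * μ) ^ k * (S.obj K - S.obj Kopt)) := by gcongr
      _ ≤ a * ((1 - α * μ) ^ k * (specNorm S.R * (a / lambdaMin S.Q) * ‖K - Kopt‖ ^ 2)) := by
          gcongr
      _ = _ := by rw [b]; field_simp

end IsPositive

end Data

end LQR

theorem theorem2 {n m : ℕ} (hn : 0 < n) (hm : 0 < m) (S : LQR.Data n m)
    (hQ : S.Q.PosDef) (hR : S.R.PosDef) (hΩ : S.Ω.PosDef) (hS : S.stabilizing.Nonempty) :
    ∃ Kopt ∈ S.stabilizing,
      -- `Kopt` is the unique global minimizer of the LQR objective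
      (∀ K, K ≠ Kopt → S.cost Kopt < S.cost K) ∧
      ∀ a : ℝ, (S.sublevel a).Nonempty →
        -- `L_f` is a Lipschitz constant of the gradient on the sublevel set
        (∀ K ∈ S.sublevel a, DifferentiableAt ℝ S.obj K) ∧
        0 < S.LF a ∧
        (∀ K₁ ∈ S.sublevel a, ∀ K₂ ∈ S.sublevel a,
          ‖S.grad K₁ - S.grad K₂‖ ≤ S.LF a * ‖K₁ - K₂‖) ∧
        -- a PL constant exists; it is explicit if the open-loop Lyapunov operator is invertible
        (∃ μ, 0 < μ ∧ μ ≤ S.LF a ∧ S.IsPL Kopt a μ) ∧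
        (IsUnit S.lyap → 0 < S.muF a ∧ S.muF a ≤ S.LF a ∧ S.IsPL Kopt a (S.muF a)) ∧
        ∀ K₀ ∈ S.sublevel a, ∀ α : ℝ, 0 < α →
          -- invariance of the sublevel set
          (α ≤ 2 / S.LF a → ∀ k, S.gd α K₀ k ∈ S.sublevel a) ∧
          -- linear convergence
          (α ≤ 1 / S.LF a → ∀ μ, 0 < μ → S.IsPL Kopt a μ → ∀ k,
            S.obj (S.gd α K₀ k) - S.obj Kopt
                ≤ (1 - α * μ) ^ k * (S.obj K₀ - S.obj Kopt) ∧
            ‖S.gd α K₀ k - Kopt‖ ^ 2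
                ≤ S.b a * (1 - α * μ) ^ k * ‖K₀ - Kopt‖ ^ 2) := by
  have hp : S.IsPositive := ⟨hn, hm, hQ, hR, hΩ⟩
  obtain ⟨Kopt, hKopt, hmin⟩ := hp.exists_minimizer hS
  refine ⟨Kopt, hKopt, fun K hK => ?_, fun a ⟨K, hK⟩ => ⟨fun K hK =>
    (hp.hasFDerivAt_obj hK.1).differentiableAt, hp.LF_pos hK, fun K₁ h₁ K₂ h₂ =>
    hp.norm_grad_sub_le h₁ h₂, ⟨S.plConst a, hp.plConst_pos hK, hp.plConst_le_LF hK,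
    hp.isPL_plConst hKopt hmin⟩, fun _ => ⟨hp.muF_pos hK, (hp.muF_le_plConst hK).trans
    (hp.plConst_le_LF hK), LQR.Data.IsPositive.isPL_of_le hmin (hp.muF_le_plConst hK)
    (hp.isPL_plConst hKopt hmin)⟩, fun K₀ hK₀ α hα => ⟨hp.gd_mem hK₀ hα,
    fun hαL μ _ hPL => hp.gd_gap hKopt hmin hK₀ hα hαL hPL⟩⟩⟩
  rw [LQR.Data.cost, if_pos hKopt, LQR.Data.cost]
  split_ifs with hs
  · rw [EReal.coe_lt_coe_iff, ← sub_pos]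
    have h := hp.quadratic_growth (a := S.obj K) ⟨hs, le_rfl⟩ hKopt (hp.E_eq_zero hKopt hmin)
    have h1 := norm_pos_iff.2 (sub_ne_zero.2 hK)
    have h2 := hp.nu_pos hS
    have h3 := hp.lambdaMin_R_pos
    have h4 := hp.obj_pos hs
    exact lt_of_lt_of_le (by positivity) h
  · exact EReal.coe_lt_top _
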